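/- Conventions. An algorithm over a field $\mathbb F$ is a straight-line program: a sequence of operations $+,-,\times,/$ applied to inputs, constants of $\mathbb F$ and earlier results, with no division by $0$ on the inputs considered (over a commutative $\mathbb F$-algebra, division only by units); each operation costs $1$. Let $\omega,c\in\mathbb R$ be such that for every $n\ge 1$ two $n\times n$ matrices can be multiplied by such a program, with constants in $\mathbb F$ and correct over every commutative $\mathbb F$-algebra, in at most $c\,n^{\omega}$ operations. Let $\mathcal M:\mathbb N\to\mathbb R$ be such that for every $n\ge 1$ two polynomials over $\mathbb F$ of degree at most $n$ can be multiplied in at most $\mathcal M(n)$ operations over $\mathbb F$, and such that $\mathcal M(n)/n$ is nondecreasing for $n \ge 1$. An $N\times N$ matrix $\mathbf A$ over $\mathbb F$ (indices from $0$) has recurrence width $t$ if the polynomials $a_i(X)=\sum_{j=0}^{N-1}\mathbf A[i,j]X^j$ satisfy $\deg a_i\le i$ for $i<t$ and $$a_i(X)=\sum_{j=1}^{t}g_{i,j}(X)\,a_{i-j}(X)\qquad (t\le i<N)$$ for some $g_{i,j}\in\mathbb F[X]$ with $\deg g_{i,j}\le j$. Such a matrix is given by the coefficients of the $a_i$, $i<t$,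 and of the $g_{i,j}$, $t\le i<N$, $1\le j\le t$. Theorem. There is a constant $K>0$, depending only on $\omega$ and $c$, such that for all $\mathbb F$ and $\mathcal M$ as above, all $N\ge 2$ and all $t\ge 1$ there are two straight-line programs over $\mathbb F$ (depending on $N$ and $t$, but not on the matrix), a pre-processing program with at most $K\,t^{\omega}\mathcal M(N)\log N$ operations and a solving program with at most $K\,t^{2}\mathcal M(N)\log^2 N$ operations, with the following property. For every invertible $N\times N$ matrix $\mathbf A$ over $\mathbb F$ of recurrence width $t$, given by the coefficients above, the pre-processing program is defined and outputs a vector $p$ over $\mathbb F$ such that, for every $\mathbf y\in\mathbb F^N$, the solving program is defined on $(p,\mathbf y)$ and outputs an $\mathbf x\in\mathbb F^N$ with $\mathbf A^{T}\mathbf x=\mathbf y$. -/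

import Mathlib

open Polynomial

universe u v w

/-! ### Arithmetic straight-line programs over a field -/

/-- The four arithmetic operations; each application has unit cost. -/
inductive ArithOp : Type
  | add
  | sub
  | mul
  | div

/-- What an instruction may refer to: one of the inputs (indexed by `ι`), a constant of the
field `F`, or the result of the `k`-th instruction (counted from `0`). -/
inductive Operand (F : Type u) (ι : Type v) : Type (max u v)
  | input (i : ι)
  | const (a : F)
  | result (k : ℕ)

/-- One instruction: an arithmetic operation applied to two operands. -/
structure Instr (F : Type u) (ι : Type v) : Type (max u v) where
  op : ArithOp
  lhs : Operand F ι
  rhs : Operand F ι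

/-- A straight-line program over `F` with inputs indexed by `ι` and outputs indexed by `κ`. -/
structure SLP (F : Type u) (ι : Type v) (κ : Type w) : Type (max u v w) where
  instrs : List (Instr F ι)
  out : κ → Operand F ι

/-- The number of arithmetic operations performed by a straight-line program. -/
def SLP.cost {F : Type u} {ι : Type v} {κ : Type w} (P : SLP F ι κ) : ℕ :=
  P.instrs.length

section Semantics

variable {F : Type u} [Field F] {ι : Type v} {κ : Type w} {R : Type u} [CommRing R] [Algebra F R]

/-- The value of an operand, given the inputs and the list of the results obtained so far;
`none` if it refers to a result that is not yet available. -/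
def Operand.eval (inp : ι → R) (mem : List R) : Operand F ι → Option R
  | .input i => some (inp i)
  | .const a => some (algebraMap F R a)
  | .result k => mem[k]?

open Classical in
/-- Applying an arithmetic operation in a commutative `F`-algebra. Division is defined only if the
divisor is invertible (in the field `F` itself: nonzero). -/
noncomputable def ArithOp.apply : ArithOp → R → R → Option R
  | .add, x, y => some (x + y)
  | .sub, x, y => some (x - y)
  | .mul, x, y => some (x * y)
  | .div, x, y => if IsUnit y then some (x * Ring.inverse y) else none

/-- Executing one instruction. -/
noncomputable def Instr.exec (inp : ι → R) (mem : List R) (I : Instr F ι) : Option R :=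
  (I.lhs.eval inp mem).bind fun x => (I.rhs.eval inp mem).bind fun y => I.op.apply x y

/-- Executing a list of instructions, each appending its result to the list of results;
`none` as soon as one of the instructions is undefined. -/
noncomputable def runInstrs (inp : ι → R) : List (Instr F ι) → List R → Option (List R)
  | [], mem => some mem
  | I :: l, mem => (I.exec inp mem).bind fun r => runInstrs inp l (mem ++ [r])

/-- On the inputs `inp` the program `P` runs without an undefined instruction, and its outputs
are `v`. -/
def SLP.Computes (P : SLP F ι κ) (inp : ι → R) (v : κ → R) : Prop :=
  ∃ mem : List R, runInstrs inp P.instrs [] = some mem ∧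
    ∀ k : κ, (P.out k).eval inp mem = some (v k)

end Semantics

/-! ### The cost of polynomial and of matrix multiplication -/

/-- `M n` operations over `F` suffice to multiply two polynomials of degree at most `n` over `F`
(given by, and returned as, coefficient vectors), and `M` is superlinear: `M n / n` is
nondecreasing. -/
structure IsPolyMulTime (F : Type u) [Field F] (M : ℕ → ℝ) : Prop where
  exists_program : ∀ n : ℕ, 1 ≤ n →
    ∃ P : SLP F (Fin (n + 1) ⊕ Fin (n + 1)) (Fin (2 * n + 1)),
      (P.cost : ℝ) ≤ M n ∧
      ∀ p q : F[X], p.natDegree ≤ n → q.natDegree ≤ n →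
        P.Computes (Sum.elim (fun i => p.coeff i) (fun i => q.coeff i))
          (fun k => (p * q).coeff k)
  superlinear : ∀ m n : ℕ, 1 ≤ m → m ≤ n → M m / m ≤ M n / n

/-- `c * n ^ ω` operations suffice to multiply two `n × n` matrices. The algorithm has constants
in `F` and works over every commutative `F`-algebra (such as `F` and `F[X]`). -/
def IsMatMulExponent (F : Type u) [Field F] (ω c : ℝ) : Prop :=
  ∀ n : ℕ, 1 ≤ n →
    ∃ P : SLP F ((Fin n × Fin n) ⊕ (Fin n × Fin n)) (Fin n × Fin n),
      (P.cost : ℝ) ≤ c * (n : ℝ) ^ ω ∧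
      ∀ (R : Type u) [CommRing R] [Algebra F R] (Y Z : Matrix (Fin n) (Fin n) R),
        P.Computes (Sum.elim (fun e => Y e.1 e.2) (fun e => Z e.1 e.2))
          (fun e => (Y * Z) e.1 e.2)

/-! ### Recurrence width -/

/-- The polynomial `a_i(X) = ∑_j A[i, j] X ^ j` of the `i`-th row of `A`. -/
noncomputable def rowPoly {F : Type u} [Field F] {N : ℕ} (A : Matrix (Fin N) (Fin N) F)
    (i : Fin N) : F[X] :=
  ∑ j : Fin N, C (A i j) * X ^ (j : ℕ)

/-- The matrix `A` satisfies the recurrence of width `t` with coefficients `g`: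
`deg a_i ≤ i` for `i < t`, and `a_i = ∑_{j = 1}^{t} g_{i, j} a_{i - j}` for `i ≥ t`, where
`deg g_{i, j} ≤ j`. The polynomial `g i j` with `j : Fin t` is `g_{i, j + 1}`, as the second index
is counted from `0` here. (The values `g i j` with `i < t` play no role.) -/
structure SatisfiesRecurrence {F : Type u} [Field F] {N t : ℕ} (A : Matrix (Fin N) (Fin N) F)
    (g : Fin N → Fin t → F[X]) : Prop where
  initial : ∀ i : Fin N, (i : ℕ) < t → (rowPoly A i).natDegree ≤ i
  degree_coeff : ∀ i : Fin N, t ≤ (i : ℕ) → ∀ j : Fin t, (g i j).natDegree ≤ (j : ℕ) + 1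
  recurrence : ∀ i : Fin N, t ≤ (i : ℕ) →
    rowPoly A i =
      ∑ j : Fin t, g i j * rowPoly A ⟨(i : ℕ) - ((j : ℕ) + 1), (Nat.sub_le _ _).trans_lt i.isLt⟩

/-- Index set of the parameters of a recurrence of width `t` for an `N × N` matrix: the
coefficients of `X ^ c`, `c ≤ i`, of the initial polynomials `a_i`, `i < t`, and the coefficients
of `X ^ c`, `c ≤ j`, of the recurrence polynomials `g_{i, j}`, `t ≤ i < N`, `1 ≤ j ≤ t`. -/
inductive RecurrenceIndex (N t : ℕ) : Type
  | initial (i : Fin N) (hi : (i : ℕ) < t) (c : Fin ((i : ℕ) + 1))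
  | coeff (i : Fin N) (hi : t ≤ (i : ℕ)) (j : Fin t) (c : Fin ((j : ℕ) + 2))

/-- The parameters by which a matrix satisfying a recurrence is given to an algorithm. -/
noncomputable def recurrenceInput {F : Type u} [Field F] {N t : ℕ} (A : Matrix (Fin N) (Fin N) F)
    (g : Fin N → Fin t → F[X]) : RecurrenceIndex N t → F
  | .initial i _ c => (rowPoly A i).coeff c
  | .coeff i _ j c => (g i j).coeff c

/-! Induction along the recurrence gives deg a_i ≤ i for all i, so A is lower triangular, and
invertibility means that the coefficient of X^i in a_i never vanishes. The system Aᵀx = y says ∑ x_i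
a_i = ∑ y_d X^d. Coefficients of degree at least h involve only the x_i with i ≥ h, so divide and
conquer applies: find the upper half of x from the upper coefficients, subtract the contribution of
these x_i to the lower ones, then find the lower half.

To subtract cheaply, cut the rows into blocks of length t. Each block is the image of its
predecessor under a matrix (1 - L)⁻¹U, where L and U hold the recurrence coefficients referring to
the same and to the previous block (`blocks_succ`, `transition_mulVec`). Products of these matrices
over dyadic intervals form a tree, and any combination of the rows under a node is a dot product of
t polynomials with the block at the start of the node (`sumTree_dotProduct`). For n = 2^l * t only n
coefficients of it are wanted, and 3n leading coefficients of that block suffice. These windows do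
not depend on y; pre-processing pushes them from the root down to the leaves
(`IsBlockRecurrence.can_windows`). The grading deg ≤ r + c - s of matrix entries is additive under
products, so all degrees at such a node are O(n). As M(n)/n is nondecreasing, every level of the
tree costs O(t^ω M(N)) in pre-processing and O(t² M(N)) in solving.

Uniformity in the matrix is handled by letting quantities be functions on a type of instances: `Can
S k T` says that k operations lead from the functions in S to those in T. The true solution is such
a function from the outset, and one shows that it can be reached. Given programs enter through
`Can.computes`; `Can.exists_program` converts back. The matrix program, correct over F[X], is run on
truncated polynomials. -/

namespace StraightLine

/-! ### Calculus of quantities computable uniformly in the instance -/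

section Known

variable {Ω : Type v} {F : Type u}

/-- The functions of the instance that are constant or belong to `S`. -/
def cl (S : Set (Ω → F)) : Set (Ω → F) := S ∪ Set.range (Function.const Ω)

variable {S S' T T' U : Set (Ω → F)} {k k' l : ℝ}

theorem subset_cl : S ⊆ cl S := Set.subset_union_left

theorem const_mem_cl (a : F) : (fun _ : Ω => a) ∈ cl S := Or.inr ⟨a, rfl⟩

theorem cl_subset (h : S ⊆ cl S') : cl S ⊆ cl S' :=
  Set.union_subset h Set.subset_union_right

theorem cl_mono (h : S ⊆ S') : cl S ⊆ cl S' := cl_subset (h.trans subset_cl)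

theorem insert_subset_cl_insert {f : Ω → F} (h : S ⊆ cl S') : insert f S ⊆ cl (insert f S') :=
  Set.insert_subset (subset_cl (Set.mem_insert _ _)) (h.trans (cl_mono (Set.subset_insert _ _)))

variable [Field F]

/-- `f` is the result of one arithmetic operation applied to constants and elements of `S`. -/
def IsStep (S : Set (Ω → F)) (f : Ω → F) : Prop :=
  ∃ a ∈ cl S, ∃ b ∈ cl S, f = a + b ∨ f = a - b ∨ f = a * b ∨ ((∀ ω, b ω ≠ 0) ∧ f = a / b)

/-- A list of functions each of which is obtained by one operation from its predecessors. -/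
def IsChain : Set (Ω → F) → List (Ω → F) → Prop
  | _, [] => True
  | S, f :: l => IsStep S f ∧ IsChain (insert f S) l

/-- At most `k` arithmetic operations, the same for all instances, suffice to compute all the
functions in `T` from those in `S` and constants. -/
def Can (S : Set (Ω → F)) (k : ℝ) (T : Set (Ω → F)) : Prop :=
  ∃ l : List (Ω → F), (l.length : ℝ) ≤ k ∧ IsChain S l ∧ T ⊆ cl (S ∪ {f | f ∈ l})

theorem zero_mem_cl : (0 : Ω → F) ∈ cl S := const_mem_cl 0

theorem IsStep.mono {f : Ω → F} (h : S ⊆ cl S') (hf : IsStep S f) : IsStep S' f := by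
  obtain ⟨a, ha, b, hb, hf⟩ := hf
  exact ⟨a, cl_subset h ha, b, cl_subset h hb, hf⟩

theorem IsChain.mono {l : List (Ω → F)} : ∀ {S S' : Set (Ω → F)}, S ⊆ cl S' →
    IsChain S l → IsChain S' l := by
  induction l with
  | nil => intros; trivial
  | cons f l ih =>
    intro S S' h hl
    exact ⟨hl.1.mono h, ih (insert_subset_cl_insert h) hl.2⟩

theorem IsChain.append {l₁ : List (Ω → F)} : ∀ {S : Set (Ω → F)} {l₂ : List (Ω → F)},
    IsChain S l₁ → IsChain (S ∪ {f | f ∈ l₁}) l₂ → IsChain S (l₁ ++ l₂) := by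
  induction l₁ with
  | nil =>
    intro S l₂ _ h
    simpa using h
  | cons f l ih =>
    intro S l₂ h₁ h₂
    refine ⟨h₁.1, ih h₁.2 (h₂.mono (Set.Subset.trans ?_ subset_cl))⟩
    rintro g (hg | hg)
    · exact Or.inl (Or.inr hg)
    · rcases List.mem_cons.1 hg with rfl | hg
      · exact Or.inl (Or.inl rfl)
      · exact Or.inr hg

theorem Can.mono (h : Can S k T) (hS : S ⊆ cl S') (hk : k ≤ k') (hT : T' ⊆ cl T) :
    Can S' k' T' := by
  obtain ⟨l, h₁, h₂, h₃⟩ := h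
  refine ⟨l, h₁.trans hk, h₂.mono hS, hT.trans (cl_subset (h₃.trans (cl_subset ?_)))⟩
  exact Set.union_subset (hS.trans (cl_mono Set.subset_union_left))
    (Set.subset_union_right.trans subset_cl)

theorem Can.mono_left (h : Can S k T) (hS : S ⊆ S') : Can S' k T :=
  h.mono (hS.trans subset_cl) le_rfl subset_cl

theorem Can.mono_cost (h : Can S k T) (hk : k ≤ k') : Can S k' T :=
  h.mono subset_cl hk subset_cl

theorem Can.mono_right (h : Can S k T) (hT : T' ⊆ cl T) : Can S k T' :=
  h.mono subset_cl le_rfl hT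

theorem Can.of_subset (h : T ⊆ cl S) (hk : 0 ≤ k) : Can S k T :=
  ⟨[], by simpa using hk, trivial, by simpa using h⟩

theorem Can.trans (h₁ : Can S k T) (h₂ : Can (S ∪ T) l U) : Can S (k + l) (T ∪ U) := by
  obtain ⟨l₁, a₁, b₁, c₁⟩ := h₁
  obtain ⟨l₂, a₂, b₂, c₂⟩ := h₂
  have hST : S ∪ T ⊆ cl (S ∪ {f | f ∈ l₁}) :=
    Set.union_subset (Set.subset_union_left.trans subset_cl) c₁
  have hl : (S ∪ {f | f ∈ l₁}) ⊆ S ∪ {f | f ∈ l₁ ++ l₂} := by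
    rintro f (hf | hf)
    · exact Or.inl hf
    · exact Or.inr (List.mem_append_left _ hf)
  refine ⟨l₁ ++ l₂, by rw [List.length_append]; push_cast; linarith, b₁.append (b₂.mono hST),
    Set.union_subset (c₁.trans (cl_mono hl)) (c₂.trans (cl_subset ?_))⟩
  refine Set.union_subset (hST.trans (cl_mono hl)) (Set.Subset.trans ?_ subset_cl)
  exact fun f hf => Or.inr (List.mem_append_right _ hf)

theorem Can.then (h₁ : Can S k T) (h₂ : Can (S ∪ T) l U) : Can S (k + l) U :=
  (h₁.trans h₂).mono_right (Set.subset_union_right.trans subset_cl)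

theorem Can.union (h₁ : Can S k T) (h₂ : Can S l U) : Can S (k + l) (T ∪ U) :=
  h₁.trans (h₂.mono_left Set.subset_union_left)

theorem Can.biUnion {α : Type*} (s : Finset α) {f : α → Set (Ω → F)} {c : α → ℝ}
    (h : ∀ a ∈ s, Can S (c a) (f a)) : Can S (∑ a ∈ s, c a) (⋃ a ∈ s, f a) := by
  classical
  induction s using Finset.induction_on with
  | empty => exact Can.of_subset (by simp) (by simp)
  | insert a s ha ih =>
    rw [Finset.sum_insert ha, Finset.set_biUnion_insert]
    exact (h a (Finset.mem_insert_self _ _)).union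
      (ih fun b hb => h b (Finset.mem_insert_of_mem hb))

theorem Can.biUnion_const {α : Type*} (s : Finset α) {f : α → Set (Ω → F)} {c : ℝ}
    (h : ∀ a ∈ s, Can S c (f a)) : Can S (s.card * c) (⋃ a ∈ s, f a) := by
  simpa using Can.biUnion s h

theorem Can.iUnion_fin {n : ℕ} {f : Fin n → Set (Ω → F)} {c : ℝ}
    (h : ∀ a, Can S c (f a)) : Can S (n * c) (⋃ a, f a) := by
  simpa using Can.biUnion_const Finset.univ fun a _ => h a

theorem Can.of_isEmpty [IsEmpty Ω] (hk : 0 ≤ k) : Can S k T :=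
  Can.of_subset (fun _ _ => Or.inr ⟨0, Subsingleton.elim _ _⟩) hk

theorem Can.of_isStep {f : Ω → F} (h : IsStep S f) : Can S 1 {f} :=
  ⟨[f], by simp, ⟨h, trivial⟩, by
    rintro g rfl
    exact subset_cl (Or.inr (by simp))⟩

variable {f g : Ω → F}

theorem Can.add (hf : f ∈ cl S) (hg : g ∈ cl S) : Can S 1 {f + g} :=
  .of_isStep ⟨f, hf, g, hg, by simp⟩

theorem Can.sub (hf : f ∈ cl S) (hg : g ∈ cl S) : Can S 1 {f - g} :=
  .of_isStep ⟨f, hf, g, hg, by simp⟩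

theorem Can.mul (hf : f ∈ cl S) (hg : g ∈ cl S) : Can S 1 {f * g} :=
  .of_isStep ⟨f, hf, g, hg, by simp⟩

/-- The divisor must be nonzero at every instance; this is why the instances will be invertible
matrices only. -/
theorem Can.div (hf : f ∈ cl S) (hg : g ∈ cl S) (h : ∀ ω, g ω ≠ 0) : Can S 1 {f / g} :=
  .of_isStep ⟨f, hf, g, hg, by simp [h]⟩

theorem Can.sum {α : Type*} (s : Finset α) {f : α → Ω → F} (h : ∀ a ∈ s, f a ∈ cl S) :
    Can S s.card {∑ a ∈ s, f a} := by
  classical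
  induction s using Finset.induction_on with
  | empty => exact Can.of_subset (by simpa using zero_mem_cl) (by simp)
  | insert a s ha ih =>
    rw [Finset.sum_insert ha, Finset.card_insert_of_notMem ha]
    push_cast
    refine (ih fun b hb => h b (Finset.mem_insert_of_mem hb)).then (Can.add ?_ ?_)
    · exact cl_mono Set.subset_union_left (h a (Finset.mem_insert_self _ _))
    · exact subset_cl (Or.inr rfl)

theorem Can.sum_mul {α : Type*} (s : Finset α) {f g : α → Ω → F} (hf : ∀ a ∈ s, f a ∈ cl S)
    (hg : ∀ a ∈ s, g a ∈ cl S) : Can S (2 * s.card) {∑ a ∈ s, f a * g a} := by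
  have h₁ := Can.biUnion_const s fun a ha => Can.mul (hf a ha) (hg a ha)
  refine (h₁.then (Can.sum s fun a ha => subset_cl (Or.inr ?_))).mono_cost (by linarith)
  exact Set.mem_biUnion ha rfl

end Known

/-! ### Translation between straight-line programs and `Can` -/

section Programs

variable {Ω : Type v} {F : Type u} [Field F] {S : Set (Ω → F)} {R : Type u} [CommRing R]
  [Algebra F R] {ι : Type*} {κ : Type*}

/-- `K f` collects the scalar functions that represent the `R`-valued `f`, and `q` is the price of
simulating one instruction. The instructions are the same for all instances, so the memories at the
various instances are the values of a single list of functions. An instance is needed to see that a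
reference points to an existing result. -/
theorem Can.runInstrs [Nonempty Ω] (K : (Ω → R) → Set (Ω → F)) {q : ℝ}
    (hconst : ∀ (S : Set (Ω → F)) (a : F), K (fun _ => algebraMap F R a) ⊆ cl S)
    (hop : ∀ (S : Set (Ω → F)) (o : ArithOp) (f g r : Ω → R), K f ⊆ cl S → K g ⊆ cl S →
      (∀ ω, o.apply (f ω) (g ω) = some (r ω)) → Can S q (K r))
    (inp : ι → Ω → R) (l : List (Instr F ι)) :
    ∀ (S : Set (Ω → F)) (mem : List (Ω → R)) (m : Ω → List R),
      (∀ i, K (inp i) ⊆ cl S) → (∀ f ∈ mem, K f ⊆ cl S) →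
      (∀ ω, runInstrs (fun i => inp i ω) l (mem.map fun f => f ω) = some (m ω)) →
      ∃ mem' : List (Ω → R), (∀ ω, m ω = mem'.map fun f => f ω) ∧
        Can S (l.length * q) (⋃ f ∈ mem', K f) := by
  have heval : ∀ (S : Set (Ω → F)) (mem : List (Ω → R)) (o : Operand F ι) (x : Ω → R),
      (∀ i, K (inp i) ⊆ cl S) → (∀ f ∈ mem, K f ⊆ cl S) →
      (∀ ω, o.eval (fun i => inp i ω) (mem.map fun f => f ω) = some (x ω)) → K x ⊆ cl S := by
    intro S mem o x hi hm hx
    cases o with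
    | input i =>
      have : x = inp i := by
        funext ω
        exact (Option.some.inj (hx ω)).symm
      exact this ▸ hi i
    | const a =>
      have : x = fun _ => algebraMap F R a := by
        funext ω
        exact (Option.some.inj (hx ω)).symm
      exact this ▸ hconst S a
    | result k =>
      simp only [Operand.eval, List.getElem?_map] at hx
      obtain ⟨f, hf⟩ : ∃ f, mem[k]? = some f := by
        obtain ⟨ω⟩ := ‹Nonempty Ω›
        have := hx ω
        rw [Option.map_eq_some_iff] at this
        exact ⟨_, this.choose_spec.1⟩
      have : x = f := by
        funext ω
        simpa [hf] using (hx ω).symm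
      exact this ▸ hm f (List.mem_of_getElem? hf)
  induction l with
  | nil =>
    intro S mem m hi hm h
    refine ⟨mem, fun ω => (Option.some.inj (h ω)).symm, Can.of_subset ?_ (by simp)⟩
    exact Set.iUnion₂_subset hm
  | cons I l ih =>
    intro S mem m hi hm h
    have h' : ∀ ω, ∃ x y r, I.lhs.eval (fun i => inp i ω) (mem.map fun f => f ω) = some x ∧
        I.rhs.eval (fun i => inp i ω) (mem.map fun f => f ω) = some y ∧
        I.op.apply x y = some r ∧
        _root_.runInstrs (fun i => inp i ω) l ((mem.map fun f => f ω) ++ [r]) = some (m ω) := by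
      intro ω
      have := h ω
      simp only [_root_.runInstrs, Instr.exec, Option.bind_eq_some_iff] at this
      obtain ⟨r, ⟨x, hx, y, hy, hr⟩, hm⟩ := this
      exact ⟨x, y, r, hx, hy, hr, hm⟩
    choose x y r hx hy hr hrun using h'
    have hKr := hop S I.op x y r (heval S mem _ x hi hm hx) (heval S mem _ y hi hm hy) hr
    have hsub : S ⊆ S ∪ K r := Set.subset_union_left
    obtain ⟨mem', hm', hc⟩ := ih (S ∪ K r) (mem ++ [r]) m (fun i => (hi i).trans (cl_mono hsub))
      (by
        intro f hf
        rcases List.mem_append.1 hf with hf | hf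
        · exact (hm f hf).trans (cl_mono hsub)
        · rw [List.mem_singleton.1 hf]
          exact Set.subset_union_right.trans subset_cl)
      (by simpa using hrun)
    refine ⟨mem', hm', (hKr.then hc).mono_cost ?_⟩
    rw [List.length_cons]
    push_cast
    linarith

/-- Running a program on inputs that are functions of the instance, with values in an algebra. -/
theorem Can.computes (K : (Ω → R) → Set (Ω → F)) {q : ℝ} (hq : 0 ≤ q)
    (hconst : ∀ (S : Set (Ω → F)) (a : F), K (fun _ => algebraMap F R a) ⊆ cl S)
    (hop : ∀ (S : Set (Ω → F)) (o : ArithOp) (f g r : Ω → R), K f ⊆ cl S → K g ⊆ cl S →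
      (∀ ω, o.apply (f ω) (g ω) = some (r ω)) → Can S q (K r))
    (P : SLP F ι κ) (inp : ι → Ω → R) (hinp : ∀ i, K (inp i) ⊆ cl S) (v : κ → Ω → R)
    (hP : ∀ ω, P.Computes (fun i => inp i ω) (fun k => v k ω)) :
    Can S (P.cost * q) (⋃ k, K (v k)) := by
  rcases isEmpty_or_nonempty Ω with hΩ | hΩ
  · exact Can.of_isEmpty (by positivity)
  choose m hm hout using hP
  obtain ⟨mem, hmem, hc⟩ := Can.runInstrs K hconst hop inp P.instrs S [] m hinp (by simp)
    (by simpa using hm)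
  refine hc.then (l := 0) (Can.of_subset ?_ le_rfl) |>.mono_cost (by simp [SLP.cost])
  refine Set.iUnion_subset fun k => ?_
  cases ho : P.out k with
  | input i =>
    have : v k = inp i := by
      funext ω
      have := hout ω k
      rw [ho] at this
      exact (Option.some.inj this).symm
    exact this ▸ (hinp i).trans (cl_mono Set.subset_union_left)
  | const a =>
    have : v k = fun _ => algebraMap F R a := by
      funext ω
      have := hout ω k
      rw [ho] at this
      exact (Option.some.inj this).symm
    exact this ▸ hconst _ a
  | result j =>
    have hv : ∀ ω, (mem[j]?).map (fun f => f ω) = some (v k ω) := by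
      intro ω
      have := hout ω k
      rw [ho, hmem ω] at this
      simpa [Operand.eval] using this
    obtain ⟨f, hf⟩ : ∃ f, mem[j]? = some f := by
      obtain ⟨ω⟩ := hΩ
      obtain ⟨f, hf, -⟩ := Option.map_eq_some_iff.1 (hv ω)
      exact ⟨f, hf⟩
    have : v k = f := by
      funext ω
      simpa [hf] using (hv ω).symm
    rw [this]
    refine Set.Subset.trans ?_ (Set.subset_union_right.trans subset_cl)
    exact Set.subset_biUnion_of_mem (u := fun f => K f) (List.mem_of_getElem? hf)

theorem Can.computes_field (P : SLP F ι κ) (inp : ι → Ω → F) (hinp : ∀ i, inp i ∈ cl S)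
    (v : κ → Ω → F) (hP : ∀ ω, P.Computes (fun i => inp i ω) (fun k => v k ω)) :
    Can S P.cost (Set.range v) := by
  have := Can.computes (S := S) (fun f => ({f} : Set (Ω → F))) zero_le_one
    (fun S a => by simpa using const_mem_cl a) ?_ P inp (by simpa using hinp) v hP
  · simpa using this
  · intro S o f g r hf hg hr
    rw [Set.singleton_subset_iff] at hf hg
    refine Can.of_isStep ⟨f, hf, g, hg, ?_⟩
    cases o with
    | add => exact Or.inl (funext fun ω => (Option.some.inj (hr ω)).symm)
    | sub => exact Or.inr (Or.inl (funext fun ω => (Option.some.inj (hr ω)).symm))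
    | mul => exact Or.inr (Or.inr (Or.inl (funext fun ω => (Option.some.inj (hr ω)).symm)))
    | div =>
      simp only [ArithOp.apply, Option.ite_none_right_eq_some, Option.some.injEq,
        isUnit_iff_ne_zero, Ring.inverse_eq_inv'] at hr
      exact Or.inr (Or.inr (Or.inr ⟨fun ω => (hr ω).1, funext fun ω => by
        rw [← (hr ω).2, Pi.div_apply, div_eq_mul_inv]⟩))

theorem exists_operand (inp : ι → Ω → F) (mem : List (Ω → F)) {f : Ω → F}
    (hf : f ∈ cl (Set.range inp ∪ {g | g ∈ mem})) :
    ∃ o : Operand F ι, ∀ (ω : Ω) (l : List F),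
      o.eval (fun i => inp i ω) ((mem.map fun g => g ω) ++ l) = some (f ω) := by
  rcases hf with (⟨i, rfl⟩ | hf) | ⟨a, rfl⟩
  · exact ⟨.input i, fun _ _ => rfl⟩
  · obtain ⟨k, hk, rfl⟩ := List.getElem_of_mem hf
    refine ⟨.result k, fun ω l => ?_⟩
    rw [Operand.eval, List.getElem?_append_left (by simpa using hk)]
    simp [hk]
  · exact ⟨.const a, fun _ _ => rfl⟩

theorem exists_instrs (inp : ι → Ω → F) (l : List (Ω → F)) : ∀ mem : List (Ω → F),
    IsChain (Set.range inp ∪ {g | g ∈ mem}) l →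
    ∃ L : List (Instr F ι), L.length = l.length ∧
      ∀ ω, runInstrs (fun i => inp i ω) L (mem.map fun g => g ω)
        = some ((mem ++ l).map fun g => g ω) := by
  induction l with
  | nil => exact fun mem _ => ⟨[], rfl, fun ω => by simp [runInstrs]⟩
  | cons f l ih =>
    rintro mem ⟨⟨a, ha, b, hb, hf⟩, hl⟩
    obtain ⟨L, hL, hrun⟩ := ih (mem ++ [f]) (hl.mono (Set.Subset.trans (by
      rintro g (rfl | hg | hg)
      · exact Or.inr (by simp)
      · exact Or.inl hg
      · exact Or.inr (List.mem_append_left _ hg)) subset_cl))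
    obtain ⟨oa, hoa⟩ := exists_operand inp mem ha
    obtain ⟨ob, hob⟩ := exists_operand inp mem hb
    obtain ⟨o, ho⟩ : ∃ o : ArithOp, ∀ ω, o.apply (a ω) (b ω) = some (f ω) := by
      rcases hf with rfl | rfl | rfl | ⟨hb0, rfl⟩
      · exact ⟨.add, fun _ => rfl⟩
      · exact ⟨.sub, fun _ => rfl⟩
      · exact ⟨.mul, fun _ => rfl⟩
      · exact ⟨.div, fun ω => by simp [ArithOp.apply, hb0 ω, div_eq_mul_inv]⟩
    refine ⟨⟨o, oa, ob⟩ :: L, by simp [hL], fun ω => ?_⟩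
    have h₁ := hoa ω []
    have h₂ := hob ω []
    rw [List.append_nil] at h₁ h₂
    have := hrun ω
    rw [List.map_append] at this
    simp only [runInstrs, Instr.exec, h₁, h₂, ho ω, Option.bind_some]
    simpa using this

/-- A computation from the inputs, uniform in the instance, is given by a straight-line program. -/
theorem Can.exists_program {inp : ι → Ω → F} {k : ℝ} {v : κ → Ω → F}
    (h : Can (Set.range inp) k (Set.range v)) :
    ∃ P : SLP F ι κ, (P.cost : ℝ) ≤ k ∧
      ∀ ω, P.Computes (fun i => inp i ω) (fun j => v j ω) := by
  obtain ⟨l, hk, hl, hv⟩ := h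
  obtain ⟨L, hL, hrun⟩ := exists_instrs inp l [] (by simpa using hl)
  choose o ho using fun j => exists_operand inp l (hv ⟨j, rfl⟩)
  refine ⟨⟨L, o⟩, by simpa [SLP.cost, hL] using hk, fun ω => ⟨_, hrun ω, fun j => ?_⟩⟩
  simpa using ho j ω []

end Programs

/-! ### Low and high parts of a polynomial -/

section Parts

variable {F : Type u} [Field F]

/-- The part of degree less than `n` of a polynomial. -/
noncomputable def lowPart (n : ℕ) (p : F[X]) : F[X] := ∑ i ∈ Finset.range n, C (p.coeff i) * X ^ i

/-- The quotient of a polynomial by `X ^ n`. -/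
noncomputable def highPart (n : ℕ) (p : F[X]) : F[X] := divX^[n] p

theorem coeff_lowPart (n : ℕ) (p : F[X]) (d : ℕ) :
    (lowPart n p).coeff d = if d < n then p.coeff d else 0 := by
  simp [lowPart, coeff_X_pow]

theorem coeff_highPart (n : ℕ) : ∀ (p : F[X]) (d : ℕ), (highPart n p).coeff d = p.coeff (d + n) := by
  induction n with
  | zero => intro p d; rfl
  | succ n ih =>
    intro p d
    have := ih (divX p) d
    rw [highPart, Function.iterate_succ_apply]
    rw [highPart] at this
    rw [this, coeff_divX, add_assoc]

theorem lowPart_add_highPart (n : ℕ) (p : F[X]) : lowPart n p + X ^ n * highPart n p = p := by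
  ext d
  rw [coeff_add, coeff_lowPart, coeff_X_pow_mul', coeff_highPart]
  by_cases h : d < n
  · rw [if_pos h, if_neg (by omega), add_zero]
  · rw [if_neg h, if_pos (by omega), zero_add, Nat.sub_add_cancel (by omega)]

theorem natDegree_lowPart_le (n : ℕ) (p : F[X]) : (lowPart (n + 1) p).natDegree ≤ n :=
  natDegree_le_iff_coeff_eq_zero.2 fun d hd => by rw [coeff_lowPart, if_neg (by omega)]

theorem natDegree_highPart_le {n k : ℕ} {p : F[X]} (h : p.natDegree ≤ n + k) :
    (highPart n p).natDegree ≤ k :=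
  natDegree_le_iff_coeff_eq_zero.2 fun d hd => by
    rw [coeff_highPart]
    exact coeff_eq_zero_of_natDegree_lt (by omega)

/-- The part of `q` below degree `k₀` contributes only below degree `k₀ + d₁`. For `k₀ = 0` nothing
is cut off; this case is separate because `k₀` will arise from truncated subtraction. -/
theorem coeff_mul_highPart {p q : F[X]} {k₀ d₁ d : ℕ} (hp : p.natDegree ≤ d₁)
    (hd : k₀ = 0 ∨ k₀ + d₁ ≤ d) : (p * q).coeff d = (p * highPart k₀ q).coeff (d - k₀) := by
  rcases hd with rfl | hd
  · rfl
  conv_lhs => rw [← lowPart_add_highPart k₀ q]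
  rw [mul_add, coeff_add, mul_left_comm, coeff_X_pow_mul', if_pos (by omega)]
  rcases k₀ with _ | k
  · simp [lowPart]
  · rw [coeff_eq_zero_of_natDegree_lt, zero_add]
    have := natDegree_lowPart_le k q
    have := natDegree_mul_le (p := p) (q := lowPart (k + 1) q)
    omega

theorem coeff_mul_lowPart {p q : F[X]} {n d : ℕ} (hd : d < n) :
    (p * q).coeff d = (lowPart n p * lowPart n q).coeff d := by
  rw [coeff_mul, coeff_mul]
  refine Finset.sum_congr rfl fun x hx => ?_
  have hx := Finset.HasAntidiagonal.mem_antidiagonal.1 hx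
  rw [coeff_lowPart, coeff_lowPart, if_pos (by omega), if_pos (by omega)]

end Parts

/-! ### Polynomials depending on the instance, known through their coefficients -/

section PolynomialFamilies

variable {Ω : Type v} {F : Type u} [Field F] {S : Set (Ω → F)}

/-- The coefficients of the powers `X ^ d`, `d ∈ I`, of a polynomial depending on the instance. -/
def coeffSet (p : Ω → F[X]) (I : Set ℕ) : Set (Ω → F) := (fun d ω => (p ω).coeff d) '' I

variable {p q : Ω → F[X]} {I J : Set ℕ}

theorem coeffSet_mono (h : I ⊆ J) : coeffSet p I ⊆ coeffSet p J := Set.image_mono h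

theorem coeffSet_subset (h : ∀ d ∈ I, (fun ω => (p ω).coeff d) ∈ cl S) : coeffSet p I ⊆ cl S := by
  rintro _ ⟨d, hd, rfl⟩
  exact h d hd

theorem mem_of_coeffSet_subset (h : coeffSet p I ⊆ cl S) {d : ℕ} (hd : d ∈ I) :
    (fun ω => (p ω).coeff d) ∈ cl S := h ⟨d, hd, rfl⟩

theorem coeffSet_const_subset (p : F[X]) : coeffSet (fun _ : Ω => p) I ⊆ cl S :=
  coeffSet_subset fun _ _ => const_mem_cl _

theorem zero_mem_cl' {f : Ω → F} (h : ∀ ω, f ω = 0) : f ∈ cl S := by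
  have : f = 0 := funext h
  exact this ▸ zero_mem_cl

theorem coeffSet_X_pow_mul_subset (n : ℕ) (h : coeffSet p Set.univ ⊆ cl S) :
    coeffSet (fun ω => X ^ n * p ω) Set.univ ⊆ cl S := by
  refine coeffSet_subset fun d _ => ?_
  simp only [coeff_X_pow_mul']
  split_ifs
  · exact mem_of_coeffSet_subset h (Set.mem_univ _)
  · exact zero_mem_cl

theorem coeffSet_lowPart_subset {n : ℕ} (h : coeffSet p (Set.Iio n) ⊆ cl S) :
    coeffSet (fun ω => lowPart n (p ω)) Set.univ ⊆ cl S := by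
  refine coeffSet_subset fun d _ => ?_
  simp only [coeff_lowPart]
  split_ifs with hd
  · exact mem_of_coeffSet_subset h hd
  · exact zero_mem_cl

theorem coeffSet_highPart_subset {n : ℕ} (h : coeffSet p (Set.Ici n) ⊆ cl S) :
    coeffSet (fun ω => highPart n (p ω)) Set.univ ⊆ cl S := by
  refine coeffSet_subset fun d _ => ?_
  simp only [coeff_highPart]
  exact mem_of_coeffSet_subset h (Nat.le_add_left n d)

/-- Computing coefficients one by one, all but those with index in the finite set `J` being `0`. -/
theorem Can.coeffSet (J : Finset ℕ) {c : ℝ} (hc : 0 ≤ c)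
    (h₀ : ∀ d ∈ I, d ∉ J → ∀ ω, (p ω).coeff d = 0)
    (h : ∀ d ∈ I, d ∈ J → Can S c {fun ω => (p ω).coeff d}) :
    Can S (J.card * c) (coeffSet p I) := by
  classical
  have := Can.biUnion_const (S := S) (c := c) J (f := fun d => {f | d ∈ I ∧ f = fun ω => (p ω).coeff d})
    fun d hd => by
      by_cases hI : d ∈ I
      · simpa [hI] using h d hI hd
      · exact Can.of_subset (by simp [hI]) hc
  refine this.mono_right (coeffSet_subset fun d hd => ?_)
  by_cases hJ : d ∈ J
  · exact subset_cl (Set.mem_biUnion hJ ⟨hd, rfl⟩)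
  · exact zero_mem_cl' (h₀ d hd hJ)

theorem Can.poly_sum {α : Type*} (s : Finset α) {p : α → Ω → F[X]} {n : ℕ}
    (hp : ∀ a ∈ s, ∀ ω, (p a ω).natDegree ≤ n)
    (h : ∀ a ∈ s, StraightLine.coeffSet (p a) Set.univ ⊆ cl S) :
    Can S ((n + 1) * s.card) (StraightLine.coeffSet (fun ω => ∑ a ∈ s, p a ω) Set.univ) := by
  refine (Can.coeffSet (Finset.range (n + 1)) (c := s.card) (by positivity) ?_ ?_).mono_cost (by simp)
  · intro d _ hd ω
    rw [Finset.mem_range] at hd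
    rw [finsetSum_coeff]
    exact Finset.sum_eq_zero fun a ha =>
      coeff_eq_zero_of_natDegree_lt (by have := hp a ha ω; omega)
  · intro d _ _
    have := Can.sum (S := S) s (f := fun a ω => (p a ω).coeff d) fun a ha =>
      mem_of_coeffSet_subset (h a ha) (Set.mem_univ d)
    refine this.mono_right ?_
    rw [Set.singleton_subset_iff]
    refine subset_cl ?_
    rw [Set.mem_singleton_iff]
    funext ω
    simp [finsetSum_coeff]

theorem Can.poly_add {n : ℕ} (hp : ∀ ω, (p ω).natDegree ≤ n) (hq : ∀ ω, (q ω).natDegree ≤ n)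
    (hpS : StraightLine.coeffSet p Set.univ ⊆ cl S) (hqS : StraightLine.coeffSet q Set.univ ⊆ cl S) :
    Can S (n + 1) (StraightLine.coeffSet (fun ω => p ω + q ω) Set.univ) := by
  refine (Can.coeffSet (Finset.range (n + 1)) (c := 1) (by positivity) ?_ ?_).mono_cost (by simp)
  · intro d _ hd ω
    rw [Finset.mem_range] at hd
    rw [coeff_add, coeff_eq_zero_of_natDegree_lt (by have := hp ω; omega),
      coeff_eq_zero_of_natDegree_lt (by have := hq ω; omega), add_zero]
  · intro d _ _
    simp only [coeff_add]
    exact Can.add (mem_of_coeffSet_subset hpS (Set.mem_univ d))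
      (mem_of_coeffSet_subset hqS (Set.mem_univ d))

end PolynomialFamilies

/-! ### Cost of multiplying polynomials -/

section Multiplication

/-- `B` operations suffice to multiply two polynomials of degree at most `n` that depend on the
instance. -/
def PolyMul (Ω : Type v) (F : Type u) [Field F] (n : ℕ) (B : ℝ) : Prop :=
  ∀ (S : Set (Ω → F)) (p q : Ω → F[X]), (∀ ω, (p ω).natDegree ≤ n) → (∀ ω, (q ω).natDegree ≤ n) →
    coeffSet p Set.univ ⊆ cl S → coeffSet q Set.univ ⊆ cl S →
    Can S B (coeffSet (fun ω => p ω * q ω) Set.univ)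

variable {Ω : Type v} {F : Type u} [Field F] {S : Set (Ω → F)} {n : ℕ} {B : ℝ}

theorem PolyMul.mono (h : PolyMul Ω F n B) {m : ℕ} {B' : ℝ} (hm : m ≤ n) (hB : B ≤ B') :
    PolyMul Ω F m B' := fun S p q hp hq hpS hqS =>
  (h S p q (fun ω => (hp ω).trans hm) (fun ω => (hq ω).trans hm) hpS hqS).mono_cost hB

theorem PolyMul.of_isPolyMulTime {M : ℕ → ℝ} (hM : IsPolyMulTime F M) (hn : 1 ≤ n) :
    PolyMul Ω F n (M n) := by
  intro S p q hp hq hpS hqS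
  obtain ⟨P, hP, hPc⟩ := hM.exists_program n hn
  have := Can.computes_field (S := S) P
    (Sum.elim (fun i ω => (p ω).coeff i) (fun i ω => (q ω).coeff i)) (by
      rintro (i | i)
      · exact mem_of_coeffSet_subset hpS (Set.mem_univ _)
      · exact mem_of_coeffSet_subset hqS (Set.mem_univ _))
    (fun k ω => (p ω * q ω).coeff k) (fun ω => by
      convert hPc (p ω) (q ω) (hp ω) (hq ω) using 1
      funext i
      rcases i with i | i <;> rfl)
  refine this.mono subset_cl hP (coeffSet_subset fun d _ => ?_)
  by_cases hd : d < 2 * n + 1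
  · exact subset_cl ⟨⟨d, hd⟩, rfl⟩
  · refine zero_mem_cl' fun ω => coeff_eq_zero_of_natDegree_lt ?_
    have := natDegree_mul_le (p := p ω) (q := q ω)
    have := hp ω
    have := hq ω
    omega

/-- Schoolbook splitting at X^(n+1). Superlinearity of `M` gives no upper bound at larger arguments,
so products of a constant factor larger degree are reduced to smaller ones in this way. -/
theorem PolyMul.double (h : PolyMul Ω F n B) :
    PolyMul Ω F (2 * n + 1) (4 * B + 16 * (n + 1)) := by
  intro S p q hp hq hpS hqS
  set p₀ : Ω → F[X] := fun ω => lowPart (n + 1) (p ω) with hp₀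
  set p₁ : Ω → F[X] := fun ω => highPart (n + 1) (p ω) with hp₁
  set q₀ : Ω → F[X] := fun ω => lowPart (n + 1) (q ω) with hq₀
  set q₁ : Ω → F[X] := fun ω => highPart (n + 1) (q ω) with hq₁
  have dp₀ : ∀ ω, (p₀ ω).natDegree ≤ n := fun ω => natDegree_lowPart_le n _
  have dq₀ : ∀ ω, (q₀ ω).natDegree ≤ n := fun ω => natDegree_lowPart_le n _
  have dp₁ : ∀ ω, (p₁ ω).natDegree ≤ n := fun ω =>
    natDegree_highPart_le ((hp ω).trans (by omega))
  have dq₁ : ∀ ω, (q₁ ω).natDegree ≤ n := fun ω =>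
    natDegree_highPart_le ((hq ω).trans (by omega))
  have sp₀ : coeffSet p₀ Set.univ ⊆ cl S :=
    coeffSet_lowPart_subset ((coeffSet_mono (Set.subset_univ _)).trans hpS)
  have sq₀ : coeffSet q₀ Set.univ ⊆ cl S :=
    coeffSet_lowPart_subset ((coeffSet_mono (Set.subset_univ _)).trans hqS)
  have sp₁ : coeffSet p₁ Set.univ ⊆ cl S :=
    coeffSet_highPart_subset ((coeffSet_mono (Set.subset_univ _)).trans hpS)
  have sq₁ : coeffSet q₁ Set.univ ⊆ cl S :=
    coeffSet_highPart_subset ((coeffSet_mono (Set.subset_univ _)).trans hqS)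
  have hmul := ((h S p₀ q₀ dp₀ dq₀ sp₀ sq₀).union (h S p₀ q₁ dp₀ dq₁ sp₀ sq₁)).union
    ((h S p₁ q₀ dp₁ dq₀ sp₁ sq₀).union (h S p₁ q₁ dp₁ dq₁ sp₁ sq₁))
  set r : Fin 4 → Ω → F[X] := ![fun ω => p₀ ω * q₀ ω, fun ω => X ^ (n + 1) * (p₀ ω * q₁ ω),
    fun ω => X ^ (n + 1) * (p₁ ω * q₀ ω), fun ω => X ^ (2 * n + 2) * (p₁ ω * q₁ ω)] with hr
  have hdeg : ∀ a b : F[X], a.natDegree ≤ n → b.natDegree ≤ n → ∀ m ≤ 2 * n + 2,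
      (X ^ m * (a * b)).natDegree ≤ 4 * n + 2 := by
    intro a b ha hb m hm
    have h₁ := natDegree_mul_le (p := X ^ m) (q := a * b)
    have h₂ := natDegree_mul_le (p := a) (q := b)
    rw [natDegree_X_pow] at h₁
    omega
  have hpq : (fun ω => p ω * q ω) = fun ω => ∑ a, r a ω := by
    funext ω
    rw [← lowPart_add_highPart (n + 1) (p ω), ← lowPart_add_highPart (n + 1) (q ω)]
    simp only [hr, hp₀, hp₁, hq₀, hq₁, Fin.sum_univ_four, Matrix.cons_val]
    ring
  rw [hpq]
  refine (hmul.then (Can.poly_sum Finset.univ (n := 4 * n + 2) ?_ ?_)).mono_cost ?_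
  · intro a _ ω
    fin_cases a
    · simpa [hr] using hdeg _ _ (dp₀ ω) (dq₀ ω) 0 (by omega)
    · exact hdeg _ _ (dp₀ ω) (dq₁ ω) _ (by omega)
    · exact hdeg _ _ (dp₁ ω) (dq₀ ω) _ (by omega)
    · exact hdeg _ _ (dp₁ ω) (dq₁ ω) _ (by omega)
  · intro a _
    fin_cases a
    · exact (Set.Subset.trans (fun x hx => Or.inr (Or.inl (Or.inl hx))) subset_cl)
    · exact coeffSet_X_pow_mul_subset _
        (Set.Subset.trans (fun x hx => Or.inr (Or.inl (Or.inr hx))) subset_cl)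
    · exact coeffSet_X_pow_mul_subset _
        (Set.Subset.trans (fun x hx => Or.inr (Or.inr (Or.inl hx))) subset_cl)
    · exact coeffSet_X_pow_mul_subset _
        (Set.Subset.trans (fun x hx => Or.inr (Or.inr (Or.inr hx))) subset_cl)
  · rw [Finset.card_univ, Fintype.card_fin]
    push_cast
    linarith

end Multiplication

/-! ### Dot products, matrix products and triangular systems -/

section LinearAlgebra

variable {Ω : Type v} {F : Type u} [Field F] {S : Set (Ω → F)} {n t : ℕ} {B : ℝ}

theorem PolyMul.nonneg (h : PolyMul Ω F n B) : 0 ≤ B := by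
  obtain ⟨l, hl, -⟩ := h Set.univ 0 0 (by simp) (by simp) ((Set.subset_univ _).trans subset_cl)
    ((Set.subset_univ _).trans subset_cl)
  exact (Nat.cast_nonneg _).trans hl

/-- High coefficients of `∑ s, p s * q s` from the `p s` and the high coefficients of the `q s`. -/
theorem PolyMul.dot (h : PolyMul Ω F n B) {p q : Fin t → Ω → F[X]} {k₀ d₁ : ℕ} {I : Set ℕ}
    (hI : ∀ d ∈ I, k₀ = 0 ∨ k₀ + d₁ ≤ d) (hd₁ : d₁ ≤ n) (hp : ∀ s ω, (p s ω).natDegree ≤ d₁)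
    (hq : ∀ s ω, (q s ω).natDegree ≤ k₀ + n) (hpS : ∀ s, coeffSet (p s) Set.univ ⊆ cl S)
    (hqS : ∀ s, coeffSet (q s) (Set.Ici k₀) ⊆ cl S) :
    Can S (t * (B + (2 * n + 1))) (coeffSet (fun ω => ∑ s, p s ω * q s ω) I) := by
  have h₁ : Can S (t * B) _ := Can.iUnion_fin fun s =>
    h S (p s) (fun ω => highPart k₀ (q s ω)) (fun ω => (hp s ω).trans hd₁)
      (fun ω => natDegree_highPart_le (hq s ω)) (hpS s) (coeffSet_highPart_subset (hqS s))
  have hco : ∀ d ∈ I, ∀ ω, (∑ s, p s ω * q s ω).coeff d =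
      ∑ s, (p s ω * highPart k₀ (q s ω)).coeff (d - k₀) := by
    intro d hd ω
    rw [finsetSum_coeff]
    exact Finset.sum_congr rfl fun s _ => coeff_mul_highPart (hp s ω) (hI d hd)
  refine (h₁.then (Can.coeffSet (Finset.Icc k₀ (k₀ + 2 * n)) (c := t) (by positivity)
    ?_ ?_)).mono_cost ?_
  · intro d hd hdJ ω
    rw [hco d hd]
    refine Finset.sum_eq_zero fun s _ => coeff_eq_zero_of_natDegree_lt ?_
    have a₁ := natDegree_mul_le (p := p s ω) (q := highPart k₀ (q s ω))
    have a₂ := natDegree_highPart_le (hq s ω)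
    have a₃ := hp s ω
    have a₄ := hI d hd
    rw [Finset.mem_Icc] at hdJ
    omega
  · intro d hd _
    have := Can.sum (S := S ∪ ⋃ s, coeffSet (fun ω => p s ω * highPart k₀ (q s ω)) Set.univ)
      Finset.univ (f := fun s ω => (p s ω * highPart k₀ (q s ω)).coeff (d - k₀))
      (fun s _ => subset_cl (Or.inr (Set.mem_iUnion.2 ⟨s, ⟨d - k₀, Set.mem_univ _, rfl⟩⟩)))
    rw [Finset.card_univ, Fintype.card_fin] at this
    refine this.mono_right (Set.singleton_subset_iff.2 (subset_cl ?_))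
    rw [Set.mem_singleton_iff]
    funext ω
    rw [hco d hd, Finset.sum_apply]
  · rw [Nat.card_Icc, show k₀ + 2 * n + 1 - k₀ = 2 * n + 1 by omega]
    push_cast
    linarith

/-- The coefficients of the entries of a matrix of polynomials. -/
def matCoeffs {α β : Type*} (Y : Ω → Matrix α β F[X]) : Set (Ω → F) :=
  ⋃ (i : α) (j : β), coeffSet (fun ω => Y ω i j) Set.univ

theorem coeffSet_subset_matCoeffs {α β : Type*} (Y : Ω → Matrix α β F[X]) (i : α) (j : β) :
    coeffSet (fun ω => Y ω i j) Set.univ ⊆ matCoeffs Y :=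
  Set.subset_iUnion₂ (s := fun i j => coeffSet (fun ω => Y ω i j) Set.univ) i j

theorem matCoeffs_subset {α β : Type*} {Y : Ω → Matrix α β F[X]}
    (h : ∀ i j, coeffSet (fun ω => Y ω i j) Set.univ ⊆ cl S) : matCoeffs Y ⊆ cl S :=
  Set.iUnion₂_subset h

/-- Each operation respects congruence modulo X^(n+1), so a program over F[X] can be simulated on
the coefficients of degree at most `n`, at the price `B` of one multiplication per instruction. -/
theorem Can.poly_apply (h : PolyMul Ω F n B) (hn : (n : ℝ) + 1 ≤ B) (o : ArithOp)
    (f g r : Ω → F[X]) (hf : StraightLine.coeffSet f (Set.Iio (n + 1)) ⊆ cl S)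
    (hg : StraightLine.coeffSet g (Set.Iio (n + 1)) ⊆ cl S)
    (hr : ∀ ω, o.apply (f ω) (g ω) = some (r ω)) :
    Can S B (StraightLine.coeffSet r (Set.Iio (n + 1))) := by
  have key : ∀ p : Ω → F[X], (∀ d < n + 1, Can S 1 {fun ω => (p ω).coeff d}) →
      Can S B (StraightLine.coeffSet p (Set.Iio (n + 1))) := fun p hp =>
    (Can.coeffSet (Finset.range (n + 1)) (c := 1) zero_le_one
      (fun d hd hd' => absurd (Finset.mem_range.2 hd) hd') fun d hd _ => hp d hd).mono_cost
      (by simpa using hn)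
  have hf' : ∀ d < n + 1, (fun ω => (f ω).coeff d) ∈ cl S := fun d hd =>
    mem_of_coeffSet_subset hf hd
  have hg' : ∀ d < n + 1, (fun ω => (g ω).coeff d) ∈ cl S := fun d hd =>
    mem_of_coeffSet_subset hg hd
  cases o with
  | add =>
    obtain rfl : f + g = r := funext fun ω => Option.some.inj (hr ω)
    refine key _ fun d hd => ?_
    simp only [Pi.add_apply, coeff_add]
    exact Can.add (hf' d hd) (hg' d hd)
  | sub =>
    obtain rfl : f - g = r := funext fun ω => Option.some.inj (hr ω)
    refine key _ fun d hd => ?_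
    simp only [Pi.sub_apply, coeff_sub]
    exact Can.sub (hf' d hd) (hg' d hd)
  | mul =>
    obtain rfl : f * g = r := funext fun ω => Option.some.inj (hr ω)
    have := h S (fun ω => lowPart (n + 1) (f ω)) (fun ω => lowPart (n + 1) (g ω))
      (fun ω => natDegree_lowPart_le n _) (fun ω => natDegree_lowPart_le n _)
      (coeffSet_lowPart_subset hf) (coeffSet_lowPart_subset hg)
    refine this.mono_right (coeffSet_subset fun d hd => ?_)
    exact subset_cl ⟨d, Set.mem_univ _, funext fun ω =>
      (coeff_mul_lowPart (Set.mem_Iio.1 hd)).symm⟩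
  | div =>
    simp only [ArithOp.apply, Option.ite_none_right_eq_some, Option.some.injEq] at hr
    refine key _ fun d hd => ?_
    -- Units of F[X] are nonzero constants, so this division acts coefficient by coefficient.
    have hg0 : ∀ ω, g ω = C ((g ω).coeff 0) ∧ (g ω).coeff 0 ≠ 0 := by
      intro ω
      obtain ⟨a, ha, hga⟩ := Polynomial.isUnit_iff.1 (hr ω).1
      rw [← hga, coeff_C_zero]
      exact ⟨rfl, ha.ne_zero⟩
    have hrd : ∀ ω, (r ω).coeff d = (f ω).coeff d / (g ω).coeff 0 := by
      intro ω
      have hrf := (Ring.eq_mul_inverse_iff_mul_eq _ _ _ (hr ω).1).1 (hr ω).2.symm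
      rw [eq_div_iff (hg0 ω).2, ← hrf, ← coeff_mul_C, ← (hg0 ω).1]
    simp only [hrd]
    exact Can.div (hf' d hd) (hg' 0 (by omega)) fun ω => (hg0 ω).2

/-- A matrix multiplication program that is correct over `F[X]` multiplies matrices of polynomials:
one works with truncated polynomials. -/
theorem Can.matMul (h : PolyMul Ω F n B) (hn : (n : ℝ) + 1 ≤ B)
    {P : SLP F ((Fin t × Fin t) ⊕ (Fin t × Fin t)) (Fin t × Fin t)}
    (hP : ∀ Y Z : Matrix (Fin t) (Fin t) F[X],
        P.Computes (Sum.elim (fun e => Y e.1 e.2) (fun e => Z e.1 e.2))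
          (fun e => (Y * Z) e.1 e.2)) {Y Z : Ω → Matrix (Fin t) (Fin t) F[X]}
    (hY : matCoeffs Y ⊆ cl S) (hZ : matCoeffs Z ⊆ cl S)
    (hYZ : ∀ ω i j, ((Y ω * Z ω) i j).natDegree ≤ n) :
    Can S (P.cost * B) (matCoeffs fun ω => Y ω * Z ω) := by
  have := Can.computes (S := S) (fun p : Ω → F[X] => StraightLine.coeffSet p (Set.Iio (n + 1)))
    h.nonneg (fun S a => coeffSet_const_subset (C a))
    (fun S o f g r => Can.poly_apply h hn o f g r) P
    (Sum.elim (fun e ω => Y ω e.1 e.2) (fun e ω => Z ω e.1 e.2)) (by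
      rintro (e | e)
      · exact (coeffSet_mono (Set.subset_univ _)).trans
          ((coeffSet_subset_matCoeffs Y _ _).trans hY)
      · exact (coeffSet_mono (Set.subset_univ _)).trans
          ((coeffSet_subset_matCoeffs Z _ _).trans hZ))
    (fun e ω => (Y ω * Z ω) e.1 e.2) (fun ω => by
      convert hP (Y ω) (Z ω) using 1
      funext e
      rcases e with e | e <;> rfl)
  refine this.mono_right (matCoeffs_subset fun i j => coeffSet_subset fun d _ => ?_)
  -- The inputs and intermediate results may have larger degree, but the final entries do not, so
  -- truncation loses nothing.
  by_cases hd : d < n + 1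
  · exact subset_cl (Set.mem_iUnion.2 ⟨(i, j), ⟨d, hd, rfl⟩⟩)
  · exact zero_mem_cl' fun ω => coeff_eq_zero_of_natDegree_lt (by have := hYZ ω i j; omega)

theorem Can.matAdd {Y Z : Ω → Matrix (Fin t) (Fin t) F[X]} (hY : matCoeffs Y ⊆ cl S)
    (hZ : matCoeffs Z ⊆ cl S) (hYn : ∀ ω i j, (Y ω i j).natDegree ≤ n)
    (hZn : ∀ ω i j, (Z ω i j).natDegree ≤ n) :
    Can S (t * (t * (n + 1))) (matCoeffs fun ω => Y ω + Z ω) :=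
  Can.iUnion_fin fun i => Can.iUnion_fin fun j =>
    Can.poly_add (fun ω => hYn ω i j) (fun ω => hZn ω i j)
      ((coeffSet_subset_matCoeffs Y i j).trans hY) ((coeffSet_subset_matCoeffs Z i j).trans hZ)

/-- Back substitution for a triangular system. -/
theorem Can.backSubstitution {A : Fin t → Fin t → Ω → F} {x y : Fin t → Ω → F}
    (hy : ∀ d, y d = ∑ r, x r * A r d) (hA : ∀ r d, r < d → A r d = 0)
    (hx : ∀ r, (∀ ω, A r r ω ≠ 0) ∨ x r = 0) (hAS : ∀ r d, A r d ∈ cl S) (hyS : ∀ d, y d ∈ cl S) :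
    Can S (t * (2 * t + 2)) (Set.range x) := by
  have key : ∀ m : ℕ, m ≤ t → Can S (m * (2 * t + 2)) (x '' {r | t - m ≤ (r : ℕ)}) := by
    intro m
    induction m with
    | zero =>
      intro _
      refine Can.of_subset ?_ (by simp)
      rintro _ ⟨r, hr, rfl⟩
      have := r.2
      simp only [Set.mem_ofPred_eq] at hr
      omega
    | succ m ih =>
      intro hm
      have hdt : t - (m + 1) < t := by omega
      set d : Fin t := ⟨t - (m + 1), hdt⟩ with hd
      set J := Finset.univ.filter fun r : Fin t => d < r with hJ
      have hxd : Can (S ∪ x '' {r | t - m ≤ (r : ℕ)}) (2 * t + 2) {x d} := by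
        -- The diagonal entry may vanish only for an unknown that is identically zero, and then no
        -- division is performed.
        rcases hx d with h | h
        swap
        · rw [h]
          exact Can.of_subset (Set.singleton_subset_iff.2 zero_mem_cl) (by positivity)
        have h₁ := Can.sum_mul (S := S ∪ x '' {r | t - m ≤ (r : ℕ)}) J (f := x)
          (g := fun r => A r d) (fun r hr => subset_cl (Or.inr ⟨r, by
            have : d < r := (Finset.mem_filter.1 hr).2
            rw [Fin.lt_def] at this
            simp only [hd] at this
            simp only [Set.mem_ofPred_eq]
            omega, rfl⟩)) (fun r _ => cl_mono Set.subset_union_left (hAS r d))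
        have h₂ := h₁.then (Can.sub (f := y d) (g := ∑ r ∈ J, x r * A r d)
          (cl_mono (fun _ h => Or.inl (Or.inl h)) (hyS d)) (subset_cl (Or.inr rfl)))
        have h₃ := h₂.then (Can.div (f := y d - ∑ r ∈ J, x r * A r d) (g := A d d)
          (subset_cl (Or.inr rfl)) (cl_mono (fun _ h => Or.inl (Or.inl h)) (hAS d d)) h)
        have hsum : y d = x d * A d d + ∑ r ∈ J, x r * A r d := by
          rw [hy d, ← Finset.add_sum_erase _ _ (Finset.mem_univ d)]
          congr 1
          symm
          refine Finset.sum_subset ?_ ?_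
          · intro r hr
            exact Finset.mem_erase.2 ⟨(Finset.mem_filter.1 hr).2.ne', Finset.mem_univ _⟩
          · intro r hr hr'
            rw [hA r d, mul_zero]
            have h₄ := (Finset.mem_erase.1 hr).1
            have h₅ : ¬ d < r := fun h => hr' (Finset.mem_filter.2 ⟨Finset.mem_univ _, h⟩)
            exact lt_of_le_of_ne (not_lt.1 h₅) h₄
        have heq : (y d - ∑ r ∈ J, x r * A r d) / A d d = x d := by
          rw [hsum, add_sub_cancel_right]
          funext ω
          simp [h ω]
        rw [heq] at h₃
        refine h₃.mono_cost ?_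
        have : (J.card : ℝ) ≤ t := by
          have := Finset.card_le_univ J
          rw [Fintype.card_fin] at this
          exact_mod_cast this
        linarith
      refine ((ih (by omega)).trans hxd).mono subset_cl (by push_cast; linarith) ?_
      refine Set.Subset.trans ?_ subset_cl
      rintro _ ⟨r, hr, rfl⟩
      simp only [Set.mem_ofPred_eq] at hr
      by_cases h : t - m ≤ (r : ℕ)
      · exact Or.inl ⟨r, h, rfl⟩
      · refine Or.inr ?_
        have : r = d := Fin.ext (by simp only [hd]; omega)
        rw [this]
        rfl
  refine (key t le_rfl).mono_right (Set.Subset.trans ?_ subset_cl)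
  rintro _ ⟨r, rfl⟩
  exact ⟨r, by simp, rfl⟩

end LinearAlgebra

/-! ### Graded matrices, transition matrices and the product tree -/

section BlockRecurrence

variable {F : Type u} [Field F] {t : ℕ}

/-- The entry `(r, s)` of the matrix has degree at most `r + c - s`. -/
def Graded (c : ℕ) (Y : Matrix (Fin t) (Fin t) F[X]) : Prop :=
  ∀ (r s : Fin t) (d : ℕ), (r : ℕ) + c < d + s → (Y r s).coeff d = 0

variable {c c' : ℕ} {Y Z : Matrix (Fin t) (Fin t) F[X]}

/-- The bounds telescope: (r + c - q) + (q + c' - s) = r + (c + c') - s. Entrywise degree bounds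
alone would grow by about t with each power of L. -/
theorem Graded.mul (hY : Graded c Y) (hZ : Graded c' Z) : Graded (c + c') (Y * Z) := by
  intro r s d hd
  rw [Matrix.mul_apply, finsetSum_coeff]
  refine Finset.sum_eq_zero fun q _ => ?_
  rw [coeff_mul]
  refine Finset.sum_eq_zero fun e he => ?_
  have he := Finset.HasAntidiagonal.mem_antidiagonal.1 he
  by_cases h : (r : ℕ) + c < e.1 + q
  · rw [hY r q _ h, zero_mul]
  · rw [hZ q s _ (by omega), mul_zero]

theorem Graded.one : Graded 0 (1 : Matrix (Fin t) (Fin t) F[X]) := by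
  intro r s d hd
  rw [Matrix.one_apply]
  split_ifs with h
  · subst h
    rw [coeff_one, if_neg (by omega)]
  · exact coeff_zero _

theorem Graded.pow (hY : Graded 0 Y) (k : ℕ) : Graded 0 (Y ^ k) := by
  induction k with
  | zero => simpa using Graded.one
  | succ k ih => simpa [pow_succ] using ih.mul hY

theorem Graded.sum {α : Type*} (s : Finset α) {f : α → Matrix (Fin t) (Fin t) F[X]}
    (h : ∀ a ∈ s, Graded c (f a)) : Graded c (∑ a ∈ s, f a) := by
  intro r q d hd
  rw [Matrix.sum_apply, finsetSum_coeff]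
  exact Finset.sum_eq_zero fun a ha => h a ha r q d hd

theorem Graded.natDegree_le (hY : Graded c Y) (r s : Fin t) : (Y r s).natDegree ≤ c + t :=
  natDegree_le_iff_coeff_eq_zero.2 fun d hd => hY r s d (by omega)

/-- Each strictly lower triangular factor pushes the support one more diagonal down, so exponents
from t on give 0. -/
theorem pow_apply_eq_zero (hY : ∀ r s, r ≤ s → Y r s = 0) (k : ℕ) :
    ∀ r s : Fin t, (r : ℕ) < s + k → (Y ^ k) r s = 0 := by
  induction k with
  | zero =>
    intro r s h
    rw [pow_zero, Matrix.one_apply_ne]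
    rintro rfl
    omega
  | succ k ih =>
    intro r s h
    rw [pow_succ, Matrix.mul_apply]
    refine Finset.sum_eq_zero fun q _ => ?_
    by_cases hq : q ≤ s
    · rw [hY q s hq, mul_zero]
    · rw [not_le, Fin.lt_def] at hq
      rw [ih r q (by omega), zero_mul]

/-- The transition matrix `(1 - L)⁻¹ * U`, for `L` with `L ^ (2 ^ m) = 0`. -/
noncomputable def transition (m : ℕ) (L U : Matrix (Fin t) (Fin t) F[X]) :
    Matrix (Fin t) (Fin t) F[X] := (∑ i ∈ Finset.range (2 ^ m), L ^ i) * U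

/-- The hypothesis reads (1 - L)v = Uw, and the geometric sum inverts 1 - L since L is nilpotent. A
power of two as number of terms lets the sum be formed by `m` doublings. -/
theorem transition_mulVec {m : ℕ} (hm : t ≤ 2 ^ m) {L U : Matrix (Fin t) (Fin t) F[X]}
    (hL : ∀ r s, r ≤ s → L r s = 0) {v w : Fin t → F[X]}
    (h : v = L.mulVec v + U.mulVec w) : v = (transition m L U).mulVec w := by
  have hpow : L ^ (2 ^ m) = 0 := by
    ext1 r s
    exact pow_apply_eq_zero hL _ r s (by omega)
  have hU : U.mulVec w = (1 - L).mulVec v := by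
    rw [Matrix.sub_mulVec, Matrix.one_mulVec]
    exact (sub_eq_of_eq_add' h).symm
  rw [transition, ← Matrix.mulVec_mulVec, hU, Matrix.mulVec_mulVec, geom_sum_mul_neg, hpow,
    sub_zero, Matrix.one_mulVec]

theorem Graded.transition {L U : Matrix (Fin t) (Fin t) F[X]} (hL : Graded 0 L)
    (hU : Graded c U) (m : ℕ) : Graded c (transition m L U) := by
  have := (Graded.sum (Finset.range (2 ^ m)) fun i _ => hL.pow i).mul hU
  rwa [zero_add] at this

/-- The product of the transition matrices of the blocks `b` with `u * 2 ^ l ≤ b < (u + 1) * 2 ^ l`. -/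
noncomputable def prodTree (T : ℕ → Matrix (Fin t) (Fin t) F[X]) :
    ℕ → ℕ → Matrix (Fin t) (Fin t) F[X]
  | 0, u => T u
  | l + 1, u => prodTree T l (2 * u + 1) * prodTree T l (2 * u)

/-- The coefficients of `∑ x b r * V (b + 1) r`, where `u * 2 ^ l ≤ b < (u + 1) * 2 ^ l`,
with respect to the entries of `V (u * 2 ^ l)`. -/
noncomputable def sumTree (T : ℕ → Matrix (Fin t) (Fin t) F[X]) (x : ℕ → Fin t → F) :
    ℕ → ℕ → Fin t → F[X]
  | 0, u => Matrix.vecMul (fun r => C (x u r)) (T u)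
  | l + 1, u => sumTree T x l (2 * u) +
      Matrix.vecMul (sumTree T x l (2 * u + 1)) (prodTree T l (2 * u))

/-- The linear combination of the entries of the first `b` blocks with coefficients `x`. -/
noncomputable def partialSum (V : ℕ → Fin t → F[X]) (x : ℕ → Fin t → F) (b : ℕ) : F[X] :=
  ∑ i ∈ Finset.range b, ∑ r, C (x i r) * V (i + 1) r

variable {T : ℕ → Matrix (Fin t) (Fin t) F[X]} {V : ℕ → Fin t → F[X]} {x : ℕ → Fin t → F}

theorem prodTree_mulVec (hV : ∀ b, V (b + 1) = (T b).mulVec (V b)) (l : ℕ) : ∀ u : ℕ,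
    V ((u + 1) * 2 ^ l) = (prodTree T l u).mulVec (V (u * 2 ^ l)) := by
  induction l with
  | zero => intro u; simpa [prodTree] using hV u
  | succ l ih =>
    intro u
    have h₁ := ih (2 * u)
    have h₂ := ih (2 * u + 1)
    rw [prodTree, ← Matrix.mulVec_mulVec, show u * 2 ^ (l + 1) = 2 * u * 2 ^ l by ring, ← h₁, ← h₂]
    congr 1
    ring

/-- All blocks under a node are linear images of the block at its start. The right half is expressed
through the middle block first, then carried to the start by the product over the left half. -/
theorem sumTree_dotProduct (hV : ∀ b, V (b + 1) = (T b).mulVec (V b)) (l : ℕ) : ∀ u : ℕ,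
    partialSum V x (u * 2 ^ l) + sumTree T x l u ⬝ᵥ V (u * 2 ^ l) =
      partialSum V x ((u + 1) * 2 ^ l) := by
  induction l with
  | zero =>
    intro u
    rw [pow_zero, mul_one, mul_one, sumTree, ← Matrix.dotProduct_mulVec, ← hV, partialSum,
      partialSum, Finset.sum_range_succ]
    rfl
  | succ l ih =>
    intro u
    have h₁ := ih (2 * u)
    have h₂ := ih (2 * u + 1)
    rw [sumTree, show u * 2 ^ (l + 1) = 2 * u * 2 ^ l by ring, add_dotProduct,
      ← Matrix.dotProduct_mulVec, ← prodTree_mulVec hV, ← add_assoc, h₁, h₂]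
    congr 1
    ring

theorem Graded.prodTree (hT : ∀ b, Graded t (T b)) (l : ℕ) : ∀ u : ℕ,
    Graded (2 ^ l * t) (prodTree T l u) := by
  induction l with
  | zero => intro u; simpa [StraightLine.prodTree] using hT u
  | succ l ih =>
    intro u
    have := (ih (2 * u + 1)).mul (ih (2 * u))
    rwa [show 2 ^ l * t + 2 ^ l * t = 2 ^ (l + 1) * t by ring] at this

theorem natDegree_prodTree_le (hT : ∀ b, Graded t (T b)) (l u : ℕ) (r s : Fin t) :
    (prodTree T l u r s).natDegree ≤ 2 * (2 ^ l * t) := by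
  have h₁ := (Graded.prodTree hT l u).natDegree_le r s
  have h₂ : t ≤ 2 ^ l * t := Nat.le_mul_of_pos_left t (by positivity)
  omega

theorem natDegree_vecMul_le {m n : ℕ} {p : Fin t → F[X]} (hp : ∀ s, (p s).natDegree ≤ m)
    (hY : ∀ r s, (Y r s).natDegree ≤ n) (s : Fin t) : (Matrix.vecMul p Y s).natDegree ≤ m + n := by
  rw [Matrix.vecMul, dotProduct]
  exact natDegree_sum_le_of_forall_le _ _ fun r _ => natDegree_mul_le.trans (add_le_add (hp r) (hY r s))

theorem natDegree_sumTree_le (hT : ∀ b, Graded t (T b)) (l : ℕ) : ∀ (u : ℕ) (s : Fin t),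
    (sumTree T x l u s).natDegree ≤ 2 * (2 ^ l * t) := by
  induction l with
  | zero =>
    intro u s
    have := natDegree_vecMul_le (p := fun r => C (x u r)) (m := 0) (fun s => (natDegree_C _).le)
      (fun r s => natDegree_prodTree_le hT 0 u r s) s
    simpa [sumTree, prodTree] using this
  | succ l ih =>
    intro u s
    have h₁ := natDegree_vecMul_le (ih (2 * u + 1)) (fun r s => natDegree_prodTree_le hT l (2 * u) r s) s
    have h₂ := ih (2 * u) s
    rw [sumTree, Pi.add_apply, pow_succ]
    refine (natDegree_add_le _ _).trans (max_le ?_ ?_)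
    · refine h₂.trans ?_
      rw [mul_right_comm]
      omega
    · refine h₁.trans (le_of_eq ?_)
      ring

/-- Triangularity by blocks: high coefficients are not affected by the unknowns of earlier blocks.
-/
theorem coeff_partialSum (hVd : ∀ b r, (V (b + 1) r).natDegree ≤ b * t + r) {b d : ℕ}
    (hd : b * t ≤ d) : (partialSum V x b).coeff d = 0 := by
  rw [partialSum, finsetSum_coeff]
  refine Finset.sum_eq_zero fun i hi => ?_
  rw [finsetSum_coeff]
  refine Finset.sum_eq_zero fun r _ => ?_
  have h₁ : (i + 1) * t ≤ b * t := Nat.mul_le_mul_right t (Finset.mem_range.1 hi)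
  have h₂ := hVd i r
  rw [add_mul, one_mul] at h₁
  rw [coeff_C_mul, coeff_eq_zero_of_natDegree_lt (by omega), mul_zero]

end BlockRecurrence

/-! ### Cost of the elementary steps at a node -/

section Algorithm

variable {Ω : Type v} {F : Type u} [Field F] {t k : ℕ}

/-- What the pre-processing computes: the tree of products of transition matrices, and the leading
coefficients of some of the polynomials of the recurrence. -/
structure PreKnown (T : Ω → ℕ → Matrix (Fin t) (Fin t) F[X]) (V : Ω → ℕ → Fin t → F[X]) (k : ℕ)
    (S : Set (Ω → F)) : Prop where
  tree : ∀ l u, l ≤ k → u < 2 ^ (k - l) → matCoeffs (fun ω => prodTree (T ω) l u) ⊆ cl S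
  window : ∀ l u s, l < k → 2 * u + 1 < 2 ^ (k - l) →
    coeffSet (fun ω => V ω ((2 * u + 1) * 2 ^ l) s)
      {d | (2 * u + 1) * (2 ^ l * t) ≤ d + 3 * (2 ^ l * t)} ⊆ cl S
  leaf : ∀ u s, u < 2 ^ k → coeffSet (fun ω => V ω (u + 1) s) {d | u * t ≤ d} ⊆ cl S

/-- A recurrence by blocks of length `t`: the next block of polynomials results from the last one
by the transition matrix. -/
structure IsBlockRecurrence (T : Ω → ℕ → Matrix (Fin t) (Fin t) F[X])
    (V : Ω → ℕ → Fin t → F[X]) : Prop where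
  step : ∀ ω b, V ω (b + 1) = (T ω b).mulVec (V ω b)
  graded : ∀ ω b, Graded t (T ω b)
  natDegree_zero : ∀ ω s, (V ω 0 s).natDegree = 0
  natDegree_succ : ∀ ω b s, (V ω (b + 1) s).natDegree ≤ b * t + s

/-- Polynomials of degree at most `8 * 2 ^ l * t` can be multiplied in `2 ^ l * β` operations,
for all `l < k` and for `l = 0`. -/
structure MulBound (Ω : Type v) (F : Type u) [Field F] (t k : ℕ) (β : ℝ) : Prop where
  polyMul : ∀ l, l = 0 ∨ l < k → PolyMul Ω F (8 * (2 ^ l * t)) (2 ^ l * β)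
  le : 17 * (t : ℝ) ≤ β

variable {T : Ω → ℕ → Matrix (Fin t) (Fin t) F[X]} {V : Ω → ℕ → Fin t → F[X]}
  {S : Set (Ω → F)} {β : ℝ}

theorem IsBlockRecurrence.natDegree_le (h : IsBlockRecurrence T V) (ω : Ω) (b : ℕ) (s : Fin t) :
    (V ω b s).natDegree ≤ b * t := by
  cases b with
  | zero => simp [h.natDegree_zero ω s]
  | succ b =>
    have := h.natDegree_succ ω b s
    rw [add_mul, one_mul]
    omega

/-- A product of two polynomials of degree at most 8 * 2^l * t has at most 16 * 2^l * t + 1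
coefficients, so adding it to something is no dearer than the multiplication; 17t ≥ 16t + 1 explains
the constant 17. -/
theorem MulBound.pos_le (h : MulBound Ω F t k β) (ht : 1 ≤ t) (l : ℕ) :
    16 * (2 ^ l * (t : ℝ)) + 1 ≤ 2 ^ l * β := by
  have h₁ : (1 : ℝ) ≤ t := by exact_mod_cast ht
  have h₂ : (1 : ℝ) ≤ 2 ^ l := one_le_pow₀ (by norm_num)
  have h₃ : (2 : ℝ) ^ l * (17 * t) ≤ 2 ^ l * β := by gcongr; exact h.le
  nlinarith [mul_le_mul h₂ h₁ zero_le_one (by positivity)]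

/-- A dot product of vectors of polynomials, the second one given by its leading coefficients. -/
theorem MulBound.dot (h : MulBound Ω F t k β) (ht : 1 ≤ t) {l : ℕ} (hl : l = 0 ∨ l < k)
    {p q : Fin t → Ω → F[X]} {k₀ d₁ : ℕ} {I : Set ℕ}
    (hI : ∀ d ∈ I, k₀ = 0 ∨ k₀ + d₁ ≤ d) (hd₁ : d₁ ≤ 8 * (2 ^ l * t))
    (hp : ∀ s ω, (p s ω).natDegree ≤ d₁)
    (hq : ∀ s ω, (q s ω).natDegree ≤ k₀ + 8 * (2 ^ l * t))
    (hpS : ∀ s, coeffSet (p s) Set.univ ⊆ cl S)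
    (hqS : ∀ s, coeffSet (q s) (Set.Ici k₀) ⊆ cl S) :
    Can S (t * (2 * (2 ^ l * β))) (coeffSet (fun ω => ∑ s, p s ω * q s ω) I) := by
  refine ((h.polyMul l hl).dot hI hd₁ hp hq hpS hqS).mono_cost ?_
  have := h.pos_le ht l
  gcongr
  push_cast
  linarith

/-- The leading coefficients of the block after a node of the tree, from those of the block before
the node. -/
theorem IsBlockRecurrence.can_window (h : IsBlockRecurrence T V) (hβ : MulBound Ω F t k β)
    (ht : 1 ≤ t) {l u κ : ℕ} (hl : l = 0 ∨ l < k) (hκ : κ ≤ 8)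
    (hT : matCoeffs (fun ω => prodTree (T ω) l u) ⊆ cl S)
    (hV : ∀ s, coeffSet (fun ω => V ω (u * 2 ^ l) s) {d | u * (2 ^ l * t) ≤ d + κ * (2 ^ l * t)}
      ⊆ cl S) :
    Can S (t * (t * (2 * (2 ^ l * β)))) (⋃ s, coeffSet (fun ω => V ω ((u + 1) * 2 ^ l) s)
      {d | (u + 3) * (2 ^ l * t) ≤ d + κ * (2 ^ l * t)}) := by
  refine Can.iUnion_fin fun r => ?_
  have hκ' : κ * (2 ^ l * t) ≤ 8 * (2 ^ l * t) := Nat.mul_le_mul_right _ hκ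
  have := hβ.dot ht hl (S := S) (p := fun s ω => prodTree (T ω) l u r s)
    (q := fun s ω => V ω (u * 2 ^ l) s) (k₀ := u * (2 ^ l * t) - κ * (2 ^ l * t))
    (d₁ := 2 * (2 ^ l * t)) (I := {d | (u + 3) * (2 ^ l * t) ≤ d + κ * (2 ^ l * t)})
    (by
      intro d hd
      -- Multiplication by entries of degree at most 2 * 2^l * t costs two units of the window; the
      -- claim gives up three. If the subtraction defining `k₀` truncates, all coefficients are
      -- known.
      rw [Set.mem_ofPred_eq, add_mul] at hd
      omega)
    (by omega)
    (fun s ω => natDegree_prodTree_le (h.graded ω) l u r s)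
    (fun s ω => (h.natDegree_le ω _ s).trans (by rw [mul_assoc]; omega))
    (fun s => (coeffSet_subset_matCoeffs (fun ω => prodTree (T ω) l u) r s).trans hT)
    (fun s => (coeffSet_mono fun d hd => by
      rw [Set.mem_Ici] at hd
      rw [Set.mem_ofPred_eq]
      omega).trans (hV s))
  convert this using 3 with ω
  rw [prodTree_mulVec (h.step ω) l u]
  rfl

variable {P : SLP F ((Fin t × Fin t) ⊕ (Fin t × Fin t)) (Fin t × Fin t)}

theorem MulBound.can_matMul (h : MulBound Ω F t k β) (ht : 1 ≤ t) {l : ℕ} (hl : l = 0 ∨ l < k)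
    (hP : ∀ Y Z : Matrix (Fin t) (Fin t) F[X],
        P.Computes (Sum.elim (fun e => Y e.1 e.2) (fun e => Z e.1 e.2))
          (fun e => (Y * Z) e.1 e.2)) {Y Z : Ω → Matrix (Fin t) (Fin t) F[X]}
    (hY : matCoeffs Y ⊆ cl S) (hZ : matCoeffs Z ⊆ cl S)
    (hYZ : ∀ ω i j, ((Y ω * Z ω) i j).natDegree ≤ 8 * (2 ^ l * t)) :
    Can S (P.cost * (2 ^ l * β)) (matCoeffs fun ω => Y ω * Z ω) := by
  refine Can.matMul (h.polyMul l hl) ?_ hP hY hZ hYZ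
  have := h.pos_le ht l
  have h₂ : (0 : ℝ) ≤ 2 ^ l * t := by positivity
  push_cast
  linarith

theorem MulBound.can_transition (h : MulBound Ω F t k β) (ht : 1 ≤ t)
    (hP : ∀ Y Z : Matrix (Fin t) (Fin t) F[X],
        P.Computes (Sum.elim (fun e => Y e.1 e.2) (fun e => Z e.1 e.2))
          (fun e => (Y * Z) e.1 e.2)) {L U : Ω → Matrix (Fin t) (Fin t) F[X]} (m : ℕ)
    (hLS : matCoeffs L ⊆ cl S) (hUS : matCoeffs U ⊆ cl S) (hL : ∀ ω, Graded 0 (L ω))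
    (hU : ∀ ω, Graded t (U ω)) :
    Can S (m * (2 * (P.cost * β) + t ^ 2 * β) + P.cost * β)
      (matCoeffs fun ω => transition m (L ω) (U ω)) := by
  have hm : ∀ {Y Z : Ω → Matrix (Fin t) (Fin t) F[X]} {S : Set (Ω → F)}, matCoeffs Y ⊆ cl S →
      matCoeffs Z ⊆ cl S → (∀ ω, Graded t (Y ω * Z ω)) →
      Can S (P.cost * β) (matCoeffs fun ω => Y ω * Z ω) := by
    intro Y Z S hY hZ hYZ
    have := h.can_matMul ht (l := 0) (Or.inl rfl) hP hY hZ fun ω i j =>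
      ((hYZ ω).natDegree_le i j).trans (by rw [pow_zero]; omega)
    simpa using this
  have hmono : ∀ {Y : Matrix (Fin t) (Fin t) F[X]}, Graded 0 Y → Graded t Y :=
    fun hY r s d hd => hY r s d (by omega)
  have hsum : ∀ (ω : Ω) (j : ℕ), Graded 0 (∑ i ∈ Finset.range j, L ω ^ i) := fun ω j =>
    Graded.sum _ fun i _ => (hL ω).pow i
  -- Doubling: with Σ the sum of the first 2^j powers, the sum of the first 2^(j+1) powers is Σ +
  -- L^(2^j) Σ. One step takes two products and one addition.
  have key : ∀ j : ℕ, Can S (j * (2 * (P.cost * β) + t ^ 2 * β))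
      ((matCoeffs fun ω => L ω ^ (2 ^ j)) ∪
        (matCoeffs fun ω => ∑ i ∈ Finset.range (2 ^ j), L ω ^ i)) := by
    intro j
    induction j with
    | zero =>
      refine Can.of_subset (Set.union_subset (by simpa using hLS) ?_) (by simp)
      simp only [pow_zero, Finset.sum_range_one]
      exact matCoeffs_subset fun i j => coeffSet_const_subset _
    | succ j ih =>
      set W := (matCoeffs fun ω => L ω ^ (2 ^ j)) ∪
        (matCoeffs fun ω => ∑ i ∈ Finset.range (2 ^ j), L ω ^ i) with hW
      have hW₁ : (matCoeffs fun ω => L ω ^ (2 ^ j)) ⊆ cl (S ∪ W) :=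
        Set.Subset.trans (fun f hf => Or.inr (Or.inl hf)) subset_cl
      have hW₂ : (matCoeffs fun ω => ∑ i ∈ Finset.range (2 ^ j), L ω ^ i) ⊆ cl (S ∪ W) :=
        Set.Subset.trans (fun f hf => Or.inr (Or.inr hf)) subset_cl
      have h₁ := hm hW₁ hW₁ fun ω => hmono (((hL ω).pow (2 ^ j)).mul ((hL ω).pow (2 ^ j)))
      have h₂ := hm hW₁ hW₂ fun ω => hmono (((hL ω).pow (2 ^ j)).mul (hsum ω (2 ^ j)))
      have h₃ := h₂.then (Can.matAdd (n := t) (hW₂.trans (cl_mono Set.subset_union_left))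
        (Set.subset_union_right.trans subset_cl)
        (fun ω r s => ((hsum ω _).natDegree_le r s).trans (by omega))
        (fun ω r s => ((((hL ω).pow (2 ^ j)).mul (hsum ω (2 ^ j))).natDegree_le r s).trans
          (by omega)))
      refine (ih.then (h₁.union h₃)).mono subset_cl ?_ ?_
      · have h₄ := h.pos_le ht 0
        have h₅ : (t : ℝ) * (t * (t + 1)) ≤ t ^ 2 * β := by
          rw [← mul_assoc, ← sq]
          gcongr
          simp only [pow_zero, one_mul] at h₄
          linarith [Nat.cast_nonneg (α := ℝ) t]
        push_cast
        linarith
      · refine Set.Subset.trans (le_of_eq ?_) subset_cl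
        congr 2
        · funext ω
          rw [pow_succ, mul_two, pow_add]
        · funext ω
          rw [pow_succ, mul_two, Finset.sum_range_add, Finset.mul_sum]
          simp only [pow_add]
  refine (key m).then (hm (Set.Subset.trans (fun f hf => Or.inr (Or.inr hf)) subset_cl)
    (hUS.trans (cl_mono Set.subset_union_left)) fun ω => ?_)
  exact (hL ω).transition (hU ω) m

end Algorithm

/-! ### The tree, the windows and the recursive solution -/

section Algorithm

variable {Ω : Type v} {F : Type u} [Field F] {t k : ℕ}
variable {T : Ω → ℕ → Matrix (Fin t) (Fin t) F[X]} {V : Ω → ℕ → Fin t → F[X]}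
  {S : Set (Ω → F)} {β : ℝ}
variable {P : SLP F ((Fin t × Fin t) ⊕ (Fin t × Fin t)) (Fin t × Fin t)}

theorem MulBound.nonneg (h : MulBound Ω F t k β) : 0 ≤ β :=
  le_trans (by positivity) h.le

/-- Going up one level halves the number of nodes and doubles the degrees, so each level of products
costs at most 2^k * P.cost * β. -/
theorem IsBlockRecurrence.can_tree (h : IsBlockRecurrence T V) (hβ : MulBound Ω F t k β)
    (ht : 1 ≤ t)
    (hP : ∀ Y Z : Matrix (Fin t) (Fin t) F[X],
        P.Computes (Sum.elim (fun e => Y e.1 e.2) (fun e => Z e.1 e.2))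
          (fun e => (Y * Z) e.1 e.2)) {τ : ℝ}
    (hT : ∀ u, u < 2 ^ k → Can S τ (matCoeffs fun ω => T ω u)) (j : ℕ) (hj : j ≤ k) :
    Can S (2 ^ k * τ + j * (2 ^ k * (P.cost * β))) (⋃ l ∈ Finset.range (j + 1),
      ⋃ u ∈ Finset.range (2 ^ (k - l)), matCoeffs fun ω => prodTree (T ω) l u) := by
  induction j with
  | zero =>
    have := Can.biUnion_const (S := S) (Finset.range (2 ^ k)) fun u hu =>
      hT u (Finset.mem_range.1 hu)
    rw [Finset.card_range] at this
    push_cast at this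
    simpa [prodTree] using this
  | succ j ih =>
    rw [Finset.range_add_one, Finset.set_biUnion_insert, Set.union_comm]
    have ih := ih (by omega)
    have hstep := Can.biUnion_const (S := S ∪ ⋃ l ∈ Finset.range (j + 1),
      ⋃ u ∈ Finset.range (2 ^ (k - l)), matCoeffs fun ω => prodTree (T ω) l u)
      (Finset.range (2 ^ (k - (j + 1)))) (c := P.cost * (2 ^ j * β))
      (f := fun u => matCoeffs fun ω => prodTree (T ω) (j + 1) u) (by
        intro u hu
        rw [Finset.mem_range] at hu
        have hk : 2 ^ (k - j) = 2 * 2 ^ (k - (j + 1)) := by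
          rw [← pow_succ']
          congr 1
          omega
        have hmem : ∀ u', u' < 2 ^ (k - j) → matCoeffs (fun ω => prodTree (T ω) j u') ⊆
            cl (S ∪ ⋃ l ∈ Finset.range (j + 1),
              ⋃ u ∈ Finset.range (2 ^ (k - l)), matCoeffs fun ω => prodTree (T ω) l u) := by
          intro u' hu'
          refine Set.Subset.trans (fun f hf => Or.inr ?_) subset_cl
          exact Set.mem_biUnion (Finset.self_mem_range_succ j)
            (Set.mem_biUnion (Finset.mem_range.2 hu') hf)
        refine hβ.can_matMul ht (Or.inr (by omega)) hP (hmem (2 * u + 1) (by omega))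
          (hmem (2 * u) (by omega)) fun ω r s => ?_
        refine (natDegree_prodTree_le (h.graded ω) (j + 1) u r s).trans ?_
        rw [pow_succ, mul_right_comm]
        omega)
    refine (ih.trans hstep).mono_cost ?_
    have hβ0 := hβ.nonneg
    have h₁ : (2 : ℝ) ^ (k - (j + 1)) * 2 ^ j ≤ 2 ^ k := by
      rw [← pow_add]
      exact pow_le_pow_right₀ (by norm_num) (by omega)
    have h₂ : (2 : ℝ) ^ (k - (j + 1)) * (P.cost * (2 ^ j * β)) ≤ 2 ^ k * (P.cost * β) := by
      calc (2 : ℝ) ^ (k - (j + 1)) * (P.cost * (2 ^ j * β))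
          = (2 ^ (k - (j + 1)) * 2 ^ j) * (P.cost * β) := by ring
        _ ≤ _ := by gcongr
    rw [Finset.card_range]
    push_cast
    linarith

/-- The leading coefficients of the polynomials of block `u * 2 ^ l`. -/
def windowSet (V : Ω → ℕ → Fin t → F[X]) (l u : ℕ) : Set (Ω → F) :=
  ⋃ s, coeffSet (fun ω => V ω (u * 2 ^ l) s) {d | u * (2 ^ l * t) ≤ d + 3 * (2 ^ l * t)}

theorem coeffSet_subset_windowSet_succ (V : Ω → ℕ → Fin t → F[X]) (l u : ℕ) (s : Fin t) :
    coeffSet (fun ω => V ω (2 * u * 2 ^ l) s) {d | 2 * u * (2 ^ l * t) ≤ d + 6 * (2 ^ l * t)} ⊆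
      windowSet V (l + 1) u := by
  have h₁ : 2 * u * 2 ^ l = u * 2 ^ (l + 1) := by ring
  have h₂ : 2 * u * (2 ^ l * t) = u * (2 ^ (l + 1) * t) := by ring
  have h₃ : 6 * (2 ^ l * t) = 3 * (2 ^ (l + 1) * t) := by ring
  rw [h₁, h₂, h₃]
  exact Set.subset_iUnion (fun s => coeffSet (fun ω => V ω (u * 2 ^ (l + 1)) s)
    {d | u * (2 ^ (l + 1) * t) ≤ d + 3 * (2 ^ (l + 1) * t)}) s

/-- A left child starts at the same block as its parent and needs a window half as long. -/
theorem windowSet_subset_windowSet_succ (V : Ω → ℕ → Fin t → F[X]) (l u : ℕ) :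
    windowSet V l (2 * u) ⊆ windowSet V (l + 1) u :=
  Set.iUnion_subset fun s => (coeffSet_mono fun d hd => by
    rw [Set.mem_ofPred_eq] at hd ⊢
    omega).trans (coeffSet_subset_windowSet_succ V l u s)

/-- Windows are passed from parents to children; only right children require work. The root window
is trivial, since block 0 is known entirely. -/
theorem IsBlockRecurrence.can_windows (h : IsBlockRecurrence T V) (hβ : MulBound Ω F t k β)
    (ht : 1 ≤ t) (hV : ∀ s, coeffSet (fun ω => V ω 0 s) Set.univ ⊆ cl S)
    (hT : ∀ l u, l ≤ k → u < 2 ^ (k - l) → matCoeffs (fun ω => prodTree (T ω) l u) ⊆ cl S)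
    (j : ℕ) (hj : j ≤ k) :
    Can S (j * (2 ^ k * (2 * t ^ 2 * β))) (⋃ i ∈ Finset.range (j + 1),
      ⋃ u ∈ Finset.range (2 ^ i), windowSet V (k - i) u) := by
  have hβ0 := hβ.nonneg
  induction j with
  | zero =>
    refine Can.of_subset ?_ (by simp)
    simp only [zero_add, Finset.range_one, Finset.mem_singleton, Set.iUnion_iUnion_eq_left,
      pow_zero, windowSet, zero_mul]
    exact Set.iUnion_subset fun s => (coeffSet_mono (Set.subset_univ _)).trans (hV s)
  | succ j ih =>
    rw [Finset.range_add_one, Finset.set_biUnion_insert, Set.union_comm]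
    have ih := ih (by omega)
    set W := ⋃ i ∈ Finset.range (j + 1), ⋃ u ∈ Finset.range (2 ^ i), windowSet V (k - i) u with hW
    obtain ⟨l, hl⟩ : ∃ l, l = k - (j + 1) := ⟨_, rfl⟩
    have hmem : ∀ u < 2 ^ j, windowSet V (l + 1) u ⊆ cl (S ∪ W) := by
      intro u hu
      refine Set.Subset.trans (fun f hf => Or.inr ?_) subset_cl
      refine Set.mem_biUnion (Finset.self_mem_range_succ j)
        (Set.mem_biUnion (Finset.mem_range.2 hu) ?_)
      rwa [show k - j = l + 1 by omega]
    have hstep := Can.biUnion_const (S := S ∪ W) (Finset.range (2 ^ (j + 1)))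
      (c := t * (t * (2 * (2 ^ l * β)))) (f := fun u => windowSet V (k - (j + 1)) u) (by
        intro u' hu'
        rw [Finset.mem_range, pow_succ] at hu'
        simp only [← hl]
        obtain ⟨u, rfl | rfl⟩ := Nat.even_or_odd' u'
        · exact Can.of_subset ((windowSet_subset_windowSet_succ V l u).trans
            (hmem u (by omega))) (by positivity)
        -- In units of 2^l * t the parent's window of length 3 has length 6. Passing through the
        -- left sibling gives all degrees from 2u - 3 on, and the right child asks for those from 2u
        -- - 2 on.
        · have := h.can_window hβ ht (S := S ∪ W) (l := l) (u := 2 * u) (κ := 6)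
            (Or.inr (by omega)) (by norm_num)
            ((hT l (2 * u) (by omega) (by
              rw [show k - l = j + 1 by omega, pow_succ]
              omega)).trans (cl_mono Set.subset_union_left))
            (fun s => (coeffSet_subset_windowSet_succ V l u s).trans (hmem u (by omega)))
          refine this.mono_right (Set.Subset.trans ?_ subset_cl)
          refine Set.iUnion_mono fun s => coeffSet_mono fun d hd => ?_
          rw [Set.mem_ofPred_eq, add_mul] at hd ⊢
          omega)
    refine (ih.trans hstep).mono_cost ?_
    have h₁ : (2 : ℝ) ^ (j + 1) * 2 ^ l = 2 ^ k := by
      rw [← pow_add]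
      congr 1
      omega
    have h₂ : (2 : ℝ) ^ (j + 1) * (t * (t * (2 * (2 ^ l * β)))) = 2 ^ k * (2 * t ^ 2 * β) := by
      rw [← h₁]
      ring
    rw [Finset.card_range]
    push_cast
    linarith

/-- The pre-processing. -/
theorem IsBlockRecurrence.exists_preKnown (h : IsBlockRecurrence T V) (hβ : MulBound Ω F t k β)
    (ht : 1 ≤ t)
    (hP : ∀ Y Z : Matrix (Fin t) (Fin t) F[X],
        P.Computes (Sum.elim (fun e => Y e.1 e.2) (fun e => Z e.1 e.2))
          (fun e => (Y * Z) e.1 e.2)) {τ : ℝ}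
    (hV : ∀ s, coeffSet (fun ω => V ω 0 s) Set.univ ⊆ cl S)
    (hT : ∀ u, u < 2 ^ k → Can S τ (matCoeffs fun ω => T ω u)) :
    ∃ Z, Can S (2 ^ k * (τ + k * (P.cost * β) + (k + 1) * (2 * t ^ 2 * β))) Z ∧
      PreKnown T V k (S ∪ Z) := by
  have h₁ := h.can_tree hβ ht hP hT k le_rfl
  set W₁ := ⋃ l ∈ Finset.range (k + 1), ⋃ u ∈ Finset.range (2 ^ (k - l)),
    matCoeffs fun ω => prodTree (T ω) l u with hW₁
  have ht₁ : ∀ l u, l ≤ k → u < 2 ^ (k - l) →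
      matCoeffs (fun ω => prodTree (T ω) l u) ⊆ W₁ := fun l u hl hu f hf =>
    Set.mem_biUnion (Finset.mem_range.2 (Nat.lt_succ_of_le hl))
      (Set.mem_biUnion (Finset.mem_range.2 hu) hf)
  have h₂ := h.can_windows hβ ht (S := S ∪ W₁)
    (fun s => (hV s).trans (cl_mono Set.subset_union_left))
    (fun l u hl hu => (ht₁ l u hl hu).trans (Set.subset_union_right.trans subset_cl)) k le_rfl
  set W₂ := ⋃ i ∈ Finset.range (k + 1), ⋃ u ∈ Finset.range (2 ^ i), windowSet V (k - i) u with hW₂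
  have ht₂ : ∀ l u, l ≤ k → u < 2 ^ (k - l) → windowSet V l u ⊆ W₂ := by
    intro l u hl hu f hf
    refine Set.mem_biUnion (Finset.mem_range.2 (Nat.lt_succ_of_le (Nat.sub_le k l)))
      (Set.mem_biUnion (Finset.mem_range.2 hu) ?_)
    rwa [Nat.sub_sub_self hl]
  have h₃ := h₁.trans h₂
  -- One more transition, from the window of block u, gives the coefficients of degree at least u *
  -- t of block u + 1, which form the triangular system at leaf u.
  have h₄ := Can.biUnion_const (S := S ∪ (W₁ ∪ W₂)) (Finset.range (2 ^ k))
    (c := t * (t * (2 * β)))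
    (f := fun u => ⋃ s, coeffSet (fun ω => V ω (u + 1) s) {d | u * t ≤ d}) (by
      intro u hu
      rw [Finset.mem_range] at hu
      have := h.can_window hβ ht (S := S ∪ (W₁ ∪ W₂)) (l := 0) (u := u) (κ := 3)
        (Or.inl rfl) (by norm_num)
        (Set.Subset.trans (fun f hf => Or.inr (Or.inl (ht₁ 0 u (by omega) hu hf))) subset_cl)
        (fun s => Set.Subset.trans (fun f hf => Or.inr (Or.inr (ht₂ 0 u (by omega) hu
          (Set.mem_iUnion.2 ⟨s, hf⟩)))) subset_cl)
      simp only [pow_zero, one_mul, mul_one] at this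
      refine this.mono_right (Set.Subset.trans ?_ subset_cl)
      refine Set.iUnion_mono fun s => coeffSet_mono fun d hd => ?_
      rw [Set.mem_ofPred_eq] at hd ⊢
      rw [add_mul]
      omega)
  refine ⟨_, (h₃.trans h₄).mono_cost (le_of_eq ?_), ?_, ?_, ?_⟩
  · rw [Finset.card_range]
    push_cast
    ring
  · intro l u hl hu
    exact Set.Subset.trans (fun f hf => Or.inr (Or.inl (Or.inl (ht₁ l u hl hu hf)))) subset_cl
  · intro l u s hl hu
    exact Set.Subset.trans (fun f hf => Or.inr (Or.inl (Or.inr (ht₂ l _ hl.le hu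
      (Set.mem_iUnion.2 ⟨s, hf⟩))))) subset_cl
  · intro u s hu
    exact Set.Subset.trans (fun f hf => Or.inr (Or.inr (Set.mem_biUnion (Finset.mem_range.2 hu)
      (Set.mem_iUnion.2 ⟨s, hf⟩)))) subset_cl

theorem PreKnown.mono {S' : Set (Ω → F)} (h : PreKnown T V k S) (hS : S ⊆ cl S') :
    PreKnown T V k S' :=
  ⟨fun l u hl hu => (h.tree l u hl hu).trans (cl_subset hS),
    fun l u s hl hu => (h.window l u s hl hu).trans (cl_subset hS),
    fun u s hu => (h.leaf u s hu).trans (cl_subset hS)⟩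

/-- Solving the part of the system that belongs to one block. -/
theorem IsBlockRecurrence.can_solve_block (h : IsBlockRecurrence T V) (hβ : MulBound Ω F t k β)
    (ht : 1 ≤ t) (hS : PreKnown T V k S) {x : Ω → ℕ → Fin t → F}
    (hx : ∀ b r, (∀ ω, (V ω (b + 1) r).coeff (b * t + r) ≠ 0) ∨ ∀ ω, x ω b r = 0) {u : ℕ}
    (hu : u < 2 ^ k)
    (hy : coeffSet (fun ω => partialSum (V ω) (x ω) (u + 1)) (Set.Ico (u * t) ((u + 1) * t)) ⊆ cl S) :
    Can S (6 * t ^ 2 * β) (Set.range (fun r ω => x ω u r) ∪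
      ⋃ s, coeffSet (fun ω => sumTree (T ω) (x ω) 0 u s) Set.univ) := by
  have h₁ : Can S (t * (2 * t + 2)) (Set.range fun r ω => x ω u r) := by
    refine Can.backSubstitution (A := fun r d ω => (V ω (u + 1) r).coeff (u * t + d))
      (y := fun d ω => (partialSum (V ω) (x ω) (u + 1)).coeff (u * t + d)) ?_ ?_ ?_ ?_ ?_
    · intro d
      funext ω
      -- The earlier blocks have degree below u * t and drop out, leaving t equations in the t
      -- unknowns of this block.
      rw [partialSum, Finset.sum_range_succ, coeff_add, ← partialSum,
        coeff_partialSum (h.natDegree_succ ω) (Nat.le_add_right _ _), zero_add, finsetSum_coeff,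
        Finset.sum_apply]
      simp only [coeff_C_mul, Pi.mul_apply]
    · intro r d hrd
      funext ω
      refine coeff_eq_zero_of_natDegree_lt ?_
      have := h.natDegree_succ ω u r
      rw [Fin.lt_def] at hrd
      omega
    · intro r
      exact (hx u r).imp id fun h => funext h
    · intro r d
      exact mem_of_coeffSet_subset (hS.leaf u r hu) (Nat.le_add_right _ _)
    · intro d
      refine mem_of_coeffSet_subset hy ⟨Nat.le_add_right _ _, ?_⟩
      rw [add_mul, one_mul]
      omega
  have h₂ : Can (S ∪ Set.range fun r ω => x ω u r) (t * (t * (2 * β)))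
      (⋃ s, coeffSet (fun ω => sumTree (T ω) (x ω) 0 u s) Set.univ) := by
    refine Can.iUnion_fin fun s => ?_
    have := hβ.dot ht (l := 0) (Or.inl rfl) (S := S ∪ Set.range fun r ω => x ω u r)
      (p := fun r ω => C (x ω u r)) (q := fun r ω => T ω u r s) (k₀ := 0) (d₁ := 0)
      (I := Set.univ) (fun _ _ => Or.inl rfl) (Nat.zero_le _) (fun r ω => (natDegree_C _).le)
      (fun r ω => ((h.graded ω u).natDegree_le r s).trans (by rw [pow_zero]; omega))
      (fun r => coeffSet_subset fun d _ => by
        simp only [coeff_C]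
        split_ifs
        · exact subset_cl (Or.inr ⟨r, rfl⟩)
        · exact zero_mem_cl)
      (fun r => (coeffSet_mono (Set.subset_univ _)).trans ((coeffSet_subset_matCoeffs
        (fun ω => T ω u) r s).trans ((hS.tree 0 u (Nat.zero_le _) hu).trans
          (cl_mono Set.subset_union_left))))
    rw [pow_zero, one_mul] at this
    exact this
  refine (h₁.trans h₂).mono_cost ?_
  have h₃ := hβ.pos_le ht 0
  have h₄ : (1 : ℝ) ≤ t := by exact_mod_cast ht
  have h₅ : (1 : ℝ) ≤ β := by
    simp only [pow_zero, one_mul] at h₃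
    linarith
  have h₆ : (t : ℝ) * t * 1 ≤ t * t * β := by gcongr
  nlinarith

/-- The part of the solution that belongs to a node of the tree, with the coefficients of the
corresponding part of the sum. -/
theorem IsBlockRecurrence.can_solve (h : IsBlockRecurrence T V) (hβ : MulBound Ω F t k β)
    (ht : 1 ≤ t) {x : Ω → ℕ → Fin t → F}
    (hx : ∀ b r, (∀ ω, (V ω (b + 1) r).coeff (b * t + r) ≠ 0) ∨ ∀ ω, x ω b r = 0) (l : ℕ)
    (hl : l ≤ k) : ∀ (u : ℕ) (_ : u < 2 ^ (k - l)) (S : Set (Ω → F)) (_ : PreKnown T V k S)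
    (_ : coeffSet (fun ω => partialSum (V ω) (x ω) ((u + 1) * 2 ^ l))
      (Set.Ico (u * (2 ^ l * t)) ((u + 1) * (2 ^ l * t))) ⊆ cl S),
    Can S ((l + 1) * (2 ^ l * (6 * t ^ 2 * β)))
      ((⋃ b ∈ Set.Ico (u * 2 ^ l) ((u + 1) * 2 ^ l), Set.range (fun r ω => x ω b r)) ∪
      ⋃ s, coeffSet (fun ω => sumTree (T ω) (x ω) l u s) Set.univ) := by
  have hβ0 := hβ.nonneg
  induction l with
  | zero =>
    intro u hu S hS hy
    simp only [pow_zero, one_mul, mul_one] at hy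
    have := h.can_solve_block hβ ht hS hx hu hy
    refine this.mono subset_cl (by simp) (Set.Subset.trans ?_ subset_cl)
    refine Set.union_subset_union_left _ (Set.iUnion₂_subset fun b hb => ?_)
    obtain rfl : b = u := by
      rw [pow_zero, mul_one, mul_one, Set.mem_Ico] at hb
      omega
    exact subset_rfl
  | succ l ih =>
    intro u hu S hS hy
    have hk : 2 ^ (k - l) = 2 * 2 ^ (k - (l + 1)) := by
      rw [← pow_succ']
      congr 1
      omega
    have ih := ih (by omega)
    obtain ⟨n, hn⟩ : ∃ n, n = 2 ^ l * t := ⟨_, rfl⟩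
    have hn' : 2 ^ (l + 1) * t = 2 * n := by rw [hn]; ring
    have hm₁ : u * (2 * n) = 2 * u * n := by ring
    have hm₂ : (u + 1) * (2 * n) = 2 * u * n + 2 * n := by ring
    have hm₃ : (2 * u + 1) * n = 2 * u * n + n := by ring
    have hm₄ : (2 * u + 1 + 1) * n = 2 * u * n + 2 * n := by ring
    have hp : (u + 1) * 2 ^ (l + 1) = (2 * u + 1 + 1) * 2 ^ l := by ring
    have hp' : u * 2 ^ (l + 1) = 2 * u * 2 ^ l := by ring
    rw [hn', hp, hm₁, hm₂] at hy
    -- The right half comes first: its coefficients are free of the unknowns of the left half.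
    have h₁ := ih (2 * u + 1) (by omega) S hS ((coeffSet_mono (Set.Ico_subset_Ico
      (by rw [← hn]; omega) (by rw [← hn]; omega))).trans hy)
    set X₁ := ⋃ b ∈ Set.Ico ((2 * u + 1) * 2 ^ l) ((2 * u + 1 + 1) * 2 ^ l),
      Set.range (fun r ω => x ω b r) with hX₁
    set W₁ := ⋃ s, coeffSet (fun ω => sumTree (T ω) (x ω) l (2 * u + 1) s) Set.univ with hW₁
    have hW₁S : ∀ s, coeffSet (fun ω => sumTree (T ω) (x ω) l (2 * u + 1) s) Set.univ ⊆
        cl (S ∪ (X₁ ∪ W₁)) := fun s =>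
      Set.Subset.trans (fun f hf => Or.inr (Or.inr (Set.mem_iUnion.2 ⟨s, hf⟩))) subset_cl
    -- The contribution of the right half in degrees from 2un on: as `sumTree` has degree at most
    -- 2n, the middle block is needed only from degree (2u + 1)n - 3n on, which is its window.
    have h₂ := hβ.dot ht (Or.inr (show l < k by omega)) (S := S ∪ (X₁ ∪ W₁))
      (p := fun s ω => sumTree (T ω) (x ω) l (2 * u + 1) s)
      (q := fun s ω => V ω ((2 * u + 1) * 2 ^ l) s) (k₀ := (2 * u + 1) * n - 3 * n) (d₁ := 2 * n)
      (I := Set.Ico (2 * u * n) ((2 * u + 1) * n))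
      (fun d hd => by
        have := hd.1
        omega)
      (by omega) (fun s ω => hn ▸ natDegree_sumTree_le (h.graded ω) l _ s)
      (fun s ω => (h.natDegree_le ω _ s).trans (by rw [mul_assoc, ← hn]; omega)) hW₁S
      (fun s => (coeffSet_mono fun d hd => by
        rw [Set.mem_Ici] at hd
        rw [Set.mem_ofPred_eq, ← hn]
        omega).trans ((hS.window l u s (by omega) (by omega)).trans
          (cl_mono Set.subset_union_left)))
    set Z := coeffSet (fun ω => ∑ s, sumTree (T ω) (x ω) l (2 * u + 1) s *
      V ω ((2 * u + 1) * 2 ^ l) s) (Set.Ico (2 * u * n) ((2 * u + 1) * n)) with hZ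
    -- Subtracting that contribution leaves the right-hand side for the left half.
    have h₃ : Can (S ∪ (X₁ ∪ W₁) ∪ Z) (n * 1) (coeffSet
        (fun ω => partialSum (V ω) (x ω) ((2 * u + 1) * 2 ^ l))
        (Set.Ico (2 * u * n) ((2 * u + 1) * n))) := by
      have := Can.coeffSet (S := S ∪ (X₁ ∪ W₁) ∪ Z)
        (p := fun ω => partialSum (V ω) (x ω) ((2 * u + 1) * 2 ^ l))
        (I := Set.Ico (2 * u * n) ((2 * u + 1) * n))
        (Finset.Ico (2 * u * n) ((2 * u + 1) * n)) zero_le_one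
        (fun d hd hd' => absurd (Finset.mem_Ico.2 hd) hd') (fun d hd _ => by
          have hsub := Can.sub (S := S ∪ (X₁ ∪ W₁) ∪ Z)
            (f := fun ω => (partialSum (V ω) (x ω) ((2 * u + 1 + 1) * 2 ^ l)).coeff d)
            (g := fun ω => (∑ s, sumTree (T ω) (x ω) l (2 * u + 1) s *
              V ω ((2 * u + 1) * 2 ^ l) s).coeff d)
            (cl_mono (fun f hf => Or.inl (Or.inl hf)) (mem_of_coeffSet_subset hy
              ⟨hd.1, hd.2.trans_le (by omega)⟩))
            (subset_cl (Or.inr ⟨d, hd, rfl⟩))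
          convert hsub using 2
          funext ω
          rw [Pi.sub_apply, ← sumTree_dotProduct (h.step ω) l (2 * u + 1), coeff_add, dotProduct,
            add_sub_cancel_right])
      rw [Nat.card_Ico, hm₃, Nat.add_sub_cancel_left] at this
      rwa [hm₃]
    set Y := coeffSet (fun ω => partialSum (V ω) (x ω) ((2 * u + 1) * 2 ^ l))
        (Set.Ico (2 * u * n) ((2 * u + 1) * n)) with hY
    have h₄ := ih (2 * u) (by omega) (S ∪ (X₁ ∪ W₁) ∪ Z ∪ Y)
      (hS.mono (Set.Subset.trans (fun f hf => Or.inl (Or.inl (Or.inl hf))) subset_cl))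
      (by rw [← hn]; exact Set.subset_union_right.trans subset_cl)
    set X₀ := ⋃ b ∈ Set.Ico (2 * u * 2 ^ l) ((2 * u + 1) * 2 ^ l),
      Set.range (fun r ω => x ω b r) with hX₀
    set W₀ := ⋃ s, coeffSet (fun ω => sumTree (T ω) (x ω) l (2 * u) s) Set.univ with hW₀
    set S' := S ∪ (X₁ ∪ W₁) ∪ Z ∪ Y ∪ (X₀ ∪ W₀) with hS'
    have h₅ : Can S' (t * (t * (2 * (2 ^ l * β)) + (((4 * n : ℕ) : ℝ) + 1)))
        (⋃ s, coeffSet (fun ω => sumTree (T ω) (x ω) (l + 1) u s) Set.univ) := by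
      refine Can.iUnion_fin fun s => ?_
      have h₆ := hβ.dot ht (Or.inr (show l < k by omega)) (S := S')
        (p := fun r ω => sumTree (T ω) (x ω) l (2 * u + 1) r)
        (q := fun r ω => prodTree (T ω) l (2 * u) r s) (k₀ := 0) (d₁ := 2 * n)
        (I := Set.univ) (fun d hd => Or.inl rfl)
        (by omega) (fun s ω => hn ▸ natDegree_sumTree_le (h.graded ω) l _ s)
        (fun r ω => (natDegree_prodTree_le (h.graded ω) l (2 * u) r s).trans (by omega))
        (fun s => (hW₁S s).trans (cl_mono fun f hf => Or.inl (Or.inl (Or.inl hf))))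
        (fun r => (coeffSet_mono (Set.subset_univ _)).trans ((coeffSet_subset_matCoeffs
          (fun ω => prodTree (T ω) l (2 * u)) r s).trans ((hS.tree l (2 * u) (by omega)
            (by omega)).trans (cl_mono fun f hf => Or.inl (Or.inl (Or.inl (Or.inl hf)))))))
      refine h₆.then (Can.poly_add (n := 4 * n) (p := fun ω => sumTree (T ω) (x ω) l (2 * u) s)
        (q := fun ω => ∑ r, sumTree (T ω) (x ω) l (2 * u + 1) r * prodTree (T ω) l (2 * u) r s)
        (fun ω => (natDegree_sumTree_le (h.graded ω) l _ s).trans (by omega))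
        (fun ω => natDegree_sum_le_of_forall_le _ _ fun r _ => natDegree_mul_le.trans
          ((add_le_add (natDegree_sumTree_le (h.graded ω) l _ r)
            (natDegree_prodTree_le (h.graded ω) l _ r s)).trans (by omega)))
        (Set.Subset.trans (fun f hf => Or.inl (Or.inr (Or.inr (Set.mem_iUnion.2 ⟨s, hf⟩))))
          subset_cl)
        (Set.subset_union_right.trans subset_cl))
    refine ((((h₁.trans h₂).trans (h₃.mono_left ?_)).trans (h₄.mono_left ?_)).trans
      (h₅.mono_left ?_)).mono subset_cl ?_ ?_
    · rw [Set.union_assoc]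
    · simp only [Set.union_assoc]
      exact subset_rfl
    · simp only [hS', Set.union_assoc]
      exact subset_rfl
    -- Besides the recursive calls, the node costs at most 6γt² with γ = 2^l * β, within the
    -- allowance 12γt² that an additional level brings.
    · have hpos := hβ.pos_le ht l
      have ht' : (1 : ℝ) ≤ t := by exact_mod_cast ht
      have hnr : (n : ℝ) = 2 ^ l * t := by rw [hn]; push_cast; rfl
      rw [← hnr] at hpos
      set γ := (2 : ℝ) ^ l * β with hγ
      have hγ0 : 0 ≤ γ := by positivity
      have hγt : γ * t ≤ γ * t ^ 2 := by
        gcongr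
        nlinarith
      have hγ1 : γ ≤ γ * t ^ 2 := by nlinarith
      have hn4 : (t : ℝ) * (4 * n + 1) ≤ t * γ := by
        gcongr
        linarith [Nat.cast_nonneg (α := ℝ) n]
      have hpow : (2 : ℝ) ^ (l + 1) * (6 * t ^ 2 * β) = 12 * (γ * t ^ 2) := by
        rw [hγ]
        ring
      have hpow' : (2 : ℝ) ^ l * (6 * t ^ 2 * β) = 6 * (γ * t ^ 2) := by
        rw [hγ]
        ring
      rw [hpow, hpow']
      push_cast
      nlinarith [Nat.cast_nonneg (α := ℝ) n]
    · refine Set.Subset.trans (Set.union_subset ?_ fun f hf => Or.inr hf) subset_cl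
      refine Set.iUnion₂_subset fun b hb => ?_
      rw [hp, hp', Set.mem_Ico] at hb
      by_cases hb' : b < (2 * u + 1) * 2 ^ l
      · exact fun f hf => Or.inl (Or.inr (Or.inl (Set.mem_biUnion (Set.mem_Ico.2 ⟨hb.1, hb'⟩) hf)))
      · exact fun f hf => Or.inl (Or.inl (Or.inl (Or.inl (Or.inl (Set.mem_biUnion
          (Set.mem_Ico.2 ⟨not_lt.1 hb', hb.2⟩) hf)))))

end Algorithm

/-! ### Lower bounds forced by the cost hypotheses, and the resulting `MulBound` -/

section LowerBounds

variable {Ω : Type v} {F : Type u} [Field F]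

theorem Can.card_le {S : Set (Ω → F)} {k : ℝ} {κ : Type*} [Fintype κ] {v : κ → Ω → F}
    (h : Can S k (Set.range v)) (hv : Function.Injective v) (hS : ∀ j, v j ∉ cl S) :
    (Fintype.card κ : ℝ) ≤ k := by
  classical
  obtain ⟨l, hl, -, hsub⟩ := h
  refine le_trans ?_ hl
  have : Finset.univ.image v ⊆ l.toFinset := by
    intro f hf
    obtain ⟨j, -, rfl⟩ := Finset.mem_image.1 hf
    rcases hsub ⟨j, rfl⟩ with (h | h) | h
    · exact absurd (Or.inl h) (hS j)
    · exact List.mem_toFinset.2 h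
    · exact absurd (Or.inr h) (hS j)
  have h₁ := (Finset.card_le_card this).trans l.toFinset_card_le
  rw [Finset.card_image_of_injective _ hv, Finset.card_univ] at h₁
  exact_mod_cast h₁

/-- The n² entries of a product are distinct functions, as matrix units show. None is an input or a
constant: each takes the value 1 but vanishes as soon as one factor is 0. So each requires an
instruction of its own. -/
theorem sq_le_cost_of_matMul {n : ℕ}
    {P : SLP F ((Fin n × Fin n) ⊕ (Fin n × Fin n)) (Fin n × Fin n)}
    (hP : ∀ Y Z : Matrix (Fin n) (Fin n) F,
        P.Computes (Sum.elim (fun e => Y e.1 e.2) (fun e => Z e.1 e.2))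
          (fun e => (Y * Z) e.1 e.2)) : (n : ℝ) ^ 2 ≤ P.cost := by
  have h := Can.computes_field (Ω := Matrix (Fin n) (Fin n) F × Matrix (Fin n) (Fin n) F) P
    (Sum.elim (fun e ω => ω.1 e.1 e.2) (fun e ω => ω.2 e.1 e.2))
    (S := Set.range (Sum.elim (fun e ω => ω.1 e.1 e.2) (fun e ω => ω.2 e.1 e.2)))
    (fun i => subset_cl ⟨i, rfl⟩) (fun e ω => (ω.1 * ω.2) e.1 e.2) (fun ω => by
      convert hP ω.1 ω.2 using 1
      funext i
      rcases i with i | i <;> rfl)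
  have key : ∀ e e' : Fin n × Fin n, (Matrix.single e.1 e.1 1 * Matrix.single e.1 e.2 1 :
      Matrix (Fin n) (Fin n) F) e'.1 e'.2 = if e = e' then 1 else 0 := by
    intro e e'
    rw [Matrix.single_mul_single_same, mul_one, Matrix.single_apply]
    simp only [Prod.ext_iff]
  have := h.card_le (fun e e' hee => by
      by_contra hne
      have h₁ := congrFun hee (Matrix.single e.1 e.1 1, Matrix.single e.1 e.2 1)
      simp only [key, if_true, if_neg hne] at h₁
      exact one_ne_zero h₁) (fun e he => by
      have hone : ∀ f : Matrix (Fin n) (Fin n) F × Matrix (Fin n) (Fin n) F → F,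
          (fun ω : Matrix (Fin n) (Fin n) F × Matrix (Fin n) (Fin n) F =>
            (ω.1 * ω.2) e.1 e.2) = f →
          f (Matrix.single e.1 e.1 1, Matrix.single e.1 e.2 1) = 1 := by
        rintro f rfl
        simp only [key, if_true]
      have hzero : ∀ f : Matrix (Fin n) (Fin n) F × Matrix (Fin n) (Fin n) F → F,
          (fun ω : Matrix (Fin n) (Fin n) F × Matrix (Fin n) (Fin n) F =>
            (ω.1 * ω.2) e.1 e.2) = f → (∀ Y, f (Y, 0) = 0) ∧ ∀ Z, f (0, Z) = 0 := by
        rintro f rfl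
        simp
      rcases he with ⟨i | i, hi⟩ | ⟨a, ha⟩
      · have h₁ := hone _ hi.symm
        have h₂ := (hzero _ hi.symm).1 (Matrix.single e.1 e.1 1)
        exact one_ne_zero (h₁.symm.trans h₂)
      · have h₁ := hone _ hi.symm
        have h₂ := (hzero _ hi.symm).2 (Matrix.single e.1 e.2 1)
        exact one_ne_zero (h₁.symm.trans h₂)
      · have h₁ := hone _ ha.symm
        have h₂ := (hzero _ ha.symm).1 0
        exact one_ne_zero (h₁.symm.trans h₂))
  simpa [sq] using this

theorem _root_.IsMatMulExponent.sq_le {ω c : ℝ} (h : IsMatMulExponent F ω c) {n : ℕ} (hn : 1 ≤ n) :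
    (n : ℝ) ^ 2 ≤ c * (n : ℝ) ^ ω := by
  obtain ⟨P, hP, hc⟩ := h n hn
  exact (sq_le_cost_of_matMul fun Y Z => hc F Y Z).trans hP

theorem _root_.IsMatMulExponent.one_le {ω c : ℝ} (h : IsMatMulExponent F ω c) : 1 ≤ c := by
  simpa using h.sq_le le_rfl

/-- A negative exponent would give n² ≤ c for all n ≥ 1. Needed to replace min t N by t in the power
with exponent ω. -/
theorem _root_.IsMatMulExponent.exponent_nonneg {ω c : ℝ} (h : IsMatMulExponent F ω c) :
    0 ≤ ω := by
  by_contra hω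
  have hc := h.one_le
  have h₁ := h.sq_le (n := ⌈c⌉₊ + 1) (Nat.le_add_left _ _)
  have h₂ := Nat.le_ceil c
  have h₃ : (1 : ℝ) ≤ ((⌈c⌉₊ + 1 : ℕ) : ℝ) := by
    push_cast
    linarith
  have h₄ : ((⌈c⌉₊ + 1 : ℕ) : ℝ) ^ ω ≤ 1 := Real.rpow_le_one_of_one_le_of_nonpos h₃ (not_le.1 hω).le
  push_cast at *
  nlinarith

theorem _root_.IsPolyMulTime.one_le {M : ℕ → ℝ} (hM : IsPolyMulTime F M) : 1 ≤ M 1 := by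
  have h := PolyMul.of_isPolyMulTime (Ω := F × F) hM le_rfl
    (Set.range ![(Prod.fst : F × F → F), Prod.snd]) (fun ω => C ω.1) (fun ω => C ω.2)
    (fun ω => by simp) (fun ω => by simp)
    (coeffSet_subset fun d _ => by
      simp only [coeff_C]
      split_ifs
      · exact subset_cl ⟨0, rfl⟩
      · exact zero_mem_cl)
    (coeffSet_subset fun d _ => by
      simp only [coeff_C]
      split_ifs
      · exact subset_cl ⟨1, rfl⟩
      · exact zero_mem_cl)
  have := (h.mono_right (T' := Set.range fun (_ : Unit) (ω : F × F) => ω.1 * ω.2) (by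
    rintro _ ⟨-, rfl⟩
    refine subset_cl ⟨0, Set.mem_univ _, ?_⟩
    funext ω
    simp)).card_le (fun _ _ _ => rfl) (fun _ he => by
      rcases he with ⟨i, hi⟩ | ⟨a, ha⟩
      · have h₁ := congrFun hi (1, 0)
        have h₂ := congrFun hi (0, 1)
        fin_cases i <;> simp at h₁ h₂
      · have h₁ := congrFun ha (1, 0)
        have h₂ := congrFun ha (1, 1)
        simp only [Function.const_apply, mul_one, mul_zero] at h₁ h₂
        exact one_ne_zero (h₂.symm.trans h₁))
  simpa using this

/-- Every multiplication is charged in proportion to its degree, at the rate M(N)/N; this makes the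
levels of the tree equally expensive. -/
theorem _root_.IsPolyMulTime.le_mul {M : ℕ → ℝ} (hM : IsPolyMulTime F M) {n N : ℕ} (hn : 1 ≤ n)
    (h : n ≤ N) : M n ≤ n * (M N / N) := by
  have h₁ := hM.superlinear n N hn h
  have h₂ : (0 : ℝ) < n := by exact_mod_cast hn
  rw [div_le_iff₀ h₂] at h₁
  linarith

theorem _root_.IsPolyMulTime.le_self {M : ℕ → ℝ} (hM : IsPolyMulTime F M) {n : ℕ} (hn : 1 ≤ n) :
    (n : ℝ) ≤ M n := by
  have h₁ := hM.superlinear 1 n le_rfl hn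
  have h₂ : (0 : ℝ) < n := by exact_mod_cast hn
  rw [le_div_iff₀ h₂, Nat.cast_one, div_one] at h₁
  nlinarith [hM.one_le]

/-- Three doublings cost 64 M(n) + 448(n + 1), and n + 1 ≤ 2n ≤ 2 M(n). -/
theorem PolyMul.eight_mul {M : ℕ → ℝ} (hM : IsPolyMulTime F M) {n : ℕ} (hn : 1 ≤ n) :
    PolyMul Ω F (8 * n) (960 * M n) := by
  refine (PolyMul.of_isPolyMulTime hM hn).double.double.double.mono (by omega) ?_
  have h₁ := hM.le_self hn
  have h₂ : (1 : ℝ) ≤ n := by exact_mod_cast hn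
  push_cast
  linarith

theorem MulBound.of_isPolyMulTime {M : ℕ → ℝ} (hM : IsPolyMulTime F M) {N t k : ℕ} (ht : 1 ≤ t)
    (htN : t ≤ N) (hk : ∀ l < k, 2 ^ l * t ≤ N) :
    MulBound Ω F t k (960 * (t * (M N / N))) := by
  have hN : 1 ≤ N := ht.trans htN
  constructor
  · intro l hl
    have hlN : 2 ^ l * t ≤ N := by
      rcases hl with rfl | hl
      · simpa using htN
      · exact hk l hl
    have h₁ : 1 ≤ 2 ^ l * t := Nat.mul_pos (by positivity) ht
    refine (PolyMul.eight_mul hM h₁).mono le_rfl ?_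
    have := hM.le_mul h₁ hlN
    push_cast at this
    linarith
  · have h₁ : (1 : ℝ) ≤ M N / N := by
      have : (0 : ℝ) < N := by exact_mod_cast hN
      rw [le_div_iff₀ this, one_mul]
      exact hM.le_self hN
    have h₂ : (0 : ℝ) ≤ t := by positivity
    nlinarith

end LowerBounds

/-! ### From the recurrence of order t to the recurrence by blocks -/

section ScalarRecurrence

variable {F : Type u} [Field F] {t : ℕ}

/-- The blocks of length `t` of a sequence, preceded by a unit vector. -/
noncomputable def blocks (t : ℕ) (a : ℕ → F[X]) : ℕ → Fin t → F[X]
  | 0, s => if (s : ℕ) + 1 = t then 1 else 0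
  | b + 1, s => a (b * t + s)

/-- The coefficients of the recurrence that refer to the same block. -/
noncomputable def lowerCoeff (γ : ℕ → ℕ → F[X]) (b : ℕ) : Matrix (Fin t) (Fin t) F[X] :=
  Matrix.of fun r s => if 1 ≤ b ∧ s < r then γ (b * t + r) (r - 1 - s) else 0

/-- The coefficients of the recurrence that refer to the preceding block. -/
noncomputable def upperCoeff (a : ℕ → F[X]) (γ : ℕ → ℕ → F[X]) (b : ℕ) :
    Matrix (Fin t) (Fin t) F[X] :=
  Matrix.of fun r s => if b = 0 then (if (s : ℕ) + 1 = t then a r else 0)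
    else if r ≤ s then γ (b * t + r) (t + r - 1 - s) else 0

variable {a : ℕ → F[X]} {γ : ℕ → ℕ → F[X]}

/-- For b ≥ 1 a lag of at most r stays inside the block and a longer one reaches the previous block.
The initial polynomials fit the same pattern: they form the last column of the matrix applied to the
unit vector in block 0. -/
theorem blocks_succ (ht : 1 ≤ t)
    (h : ∀ i, t ≤ i → a i = ∑ j ∈ Finset.range t, γ i j * a (i - (j + 1))) (b : ℕ) :
    blocks t a (b + 1) = (lowerCoeff γ b).mulVec (blocks t a (b + 1)) +
      (upperCoeff a γ b).mulVec (blocks t a b) := by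
  funext r
  have hmul : ∀ (A : Matrix (Fin t) (Fin t) F[X]) (v : Fin t → F[X]),
      A.mulVec v r = ∑ s, A r s * v s := fun _ _ => rfl
  rw [Pi.add_apply, hmul, hmul]
  cases b with
  | zero =>
    have hlast : t - 1 < t := by omega
    rw [Finset.sum_eq_zero, zero_add, Finset.sum_eq_single (⟨t - 1, hlast⟩ : Fin t)]
    · have : t - 1 + 1 = t := by omega
      simp [upperCoeff, blocks, this]
    · intro s _ hs
      have : (s : ℕ) + 1 ≠ t := fun h => hs (Fin.ext (by simp only; omega))
      simp [upperCoeff, this]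
    · simp
    · simp [lowerCoeff]
  | succ b =>
    have hi : t ≤ (b + 1) * t + r := by
      rw [add_mul, one_mul]
      omega
    have hsum : ∑ j ∈ Finset.range t, γ ((b + 1) * t + r) j * a ((b + 1) * t + r - (j + 1)) =
        ∑ s ∈ Finset.range t, γ ((b + 1) * t + r) (if s < r then r - 1 - s else t + r - 1 - s) *
          a ((b + 1) * t + r - ((if s < r then r - 1 - s else t + r - 1 - s) + 1)) := by
      have hr := r.2
      -- The passage between lags and positions within a block is an involution.
      refine Finset.sum_nbij' (fun s => if s < r then r - 1 - s else t + r - 1 - s)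
        (fun s => if s < r then r - 1 - s else t + r - 1 - s) ?_ ?_ ?_ ?_ ?_ <;>
        intro s hs <;> rw [Finset.mem_range] at hs
      · rw [Finset.mem_range]
        split_ifs <;> omega
      · rw [Finset.mem_range]
        split_ifs <;> omega
      · split_ifs <;> omega
      · split_ifs <;> omega
      · have : (if (if s < (r : ℕ) then (r : ℕ) - 1 - s else t + r - 1 - s) < (r : ℕ) then
            (r : ℕ) - 1 - (if s < (r : ℕ) then (r : ℕ) - 1 - s else t + r - 1 - s)
            else t + r - 1 - (if s < (r : ℕ) then (r : ℕ) - 1 - s else t + r - 1 - s)) = s := by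
          split_ifs <;> omega
        rw [this]
    rw [blocks, h _ hi, ← Finset.sum_add_distrib, hsum, Finset.sum_range]
    refine Finset.sum_congr rfl fun s _ => ?_
    have hs := s.2
    simp only [lowerCoeff, upperCoeff, Matrix.of_apply, Fin.lt_def, Fin.le_def, blocks]
    by_cases hsr : (s : ℕ) < r
    · rw [if_pos hsr, if_pos ⟨by omega, hsr⟩, if_neg (by omega), if_neg (by omega), zero_mul,
        add_zero]
      congr 2
      omega
    · rw [if_neg hsr, if_neg (by omega), if_neg (by omega), if_pos (by omega), zero_mul, zero_add]
      congr 2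
      rw [add_mul, one_mul]
      omega

theorem lowerCoeff_apply_of_le (γ : ℕ → ℕ → F[X]) (b : ℕ) {r s : Fin t} (h : r ≤ s) :
    lowerCoeff γ b r s = 0 := by
  rw [lowerCoeff, Matrix.of_apply, if_neg (by rw [not_and, not_lt]; exact fun _ => h)]

theorem graded_lowerCoeff (hγ : ∀ i j, (γ i j).natDegree ≤ j + 1) (b : ℕ) :
    Graded 0 (lowerCoeff γ b : Matrix (Fin t) (Fin t) F[X]) := by
  intro r s d hd
  rw [lowerCoeff, Matrix.of_apply]
  split_ifs with h
  · rw [Fin.lt_def] at h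
    have := hγ (b * t + r) (r - 1 - s)
    exact coeff_eq_zero_of_natDegree_lt (by omega)
  · exact coeff_zero _

theorem graded_upperCoeff (ha : ∀ i, (a i).natDegree ≤ i) (hγ : ∀ i j, (γ i j).natDegree ≤ j + 1)
    (b : ℕ) : Graded t (upperCoeff a γ b : Matrix (Fin t) (Fin t) F[X]) := by
  intro r s d hd
  rw [upperCoeff, Matrix.of_apply]
  split_ifs with h₁ h₂ h₃
  · have := ha r
    exact coeff_eq_zero_of_natDegree_lt (by omega)
  · exact coeff_zero _
  · rw [Fin.le_def] at h₃
    have := hγ (b * t + r) (t + r - 1 - s)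
    exact coeff_eq_zero_of_natDegree_lt (by omega)
  · exact coeff_zero _

theorem partialSum_blocks (a : ℕ → F[X]) (x : ℕ → F) (b : ℕ) :
    partialSum (blocks t a) (fun b r => x (b * t + r)) b =
      ∑ i ∈ Finset.range (b * t), C (x i) * a i := by
  induction b with
  | zero => simp [partialSum]
  | succ b ih =>
    rw [partialSum, Finset.sum_range_succ, ← partialSum, ih, add_mul, one_mul,
      Finset.sum_range_add, Finset.sum_range (n := t)]
    rfl

/-- A family of sequences of polynomials satisfying a linear recurrence of order `t`. -/
structure IsRecurrence {Ω : Type v} (t : ℕ) (a : Ω → ℕ → F[X]) (γ : Ω → ℕ → ℕ → F[X]) : Prop where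
  natDegree_le : ∀ ω i, (a ω i).natDegree ≤ i
  natDegree_coeff_le : ∀ ω i j, (γ ω i j).natDegree ≤ j + 1
  recurrence : ∀ ω i, t ≤ i →
    a ω i = ∑ j ∈ Finset.range t, γ ω i j * a ω (i - (j + 1))

theorem IsRecurrence.isBlockRecurrence {Ω : Type v} {a : Ω → ℕ → F[X]} {γ : Ω → ℕ → ℕ → F[X]}
    (h : IsRecurrence t a γ) (ht : 1 ≤ t) {m : ℕ} (hm : t ≤ 2 ^ m) :
    IsBlockRecurrence (fun ω b => transition m (lowerCoeff (γ ω) b) (upperCoeff (a ω) (γ ω) b))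
      (fun ω => blocks t (a ω)) where
  step ω b := transition_mulVec hm (fun _ _ => lowerCoeff_apply_of_le (γ ω) b)
    (blocks_succ ht (h.recurrence ω) b)
  graded ω b := (graded_lowerCoeff (h.natDegree_coeff_le ω) b).transition
    (graded_upperCoeff (h.natDegree_le ω) (h.natDegree_coeff_le ω) b) m
  natDegree_zero ω s := by
    rw [blocks]
    split_ifs <;> simp
  natDegree_succ ω b s := h.natDegree_le ω _

variable {Ω : Type v} {S : Set (Ω → F)} {k : ℕ} {β : ℝ}
  {P : SLP F ((Fin t × Fin t) ⊕ (Fin t × Fin t)) (Fin t × Fin t)}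

/-- Transition matrices, tree and windows together; t² ≤ `P.cost` absorbs the quadratic terms of
additions and windows. -/
theorem IsRecurrence.exists_preKnown {a : Ω → ℕ → F[X]} {γ : Ω → ℕ → ℕ → F[X]}
    (h : IsRecurrence t a γ) (hβ : MulBound Ω F t k β) (ht : 1 ≤ t) {m : ℕ} (hm : t ≤ 2 ^ m)
    (hP : ∀ Y Z : Matrix (Fin t) (Fin t) F[X],
        P.Computes (Sum.elim (fun e => Y e.1 e.2) (fun e => Z e.1 e.2))
          (fun e => (Y * Z) e.1 e.2)) (hPt : (t : ℝ) ^ 2 ≤ P.cost)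
    (ha : ∀ i < t, coeffSet (fun ω => a ω i) Set.univ ⊆ cl S)
    (hγ : ∀ i j, t ≤ i → j < t → coeffSet (fun ω => γ ω i j) Set.univ ⊆ cl S) :
    ∃ Z, Can S (3 * (m + k + 1) * (P.cost * (2 ^ k * β))) Z ∧
      PreKnown (fun ω b => transition m (lowerCoeff (γ ω) b) (upperCoeff (a ω) (γ ω) b))
        (fun ω => blocks t (a ω)) k (S ∪ Z) := by
  obtain ⟨Z, hZ, hpre⟩ := (h.isBlockRecurrence ht hm).exists_preKnown hβ ht hP (S := S)
    (fun s => by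
      simp only [blocks]
      exact coeffSet_const_subset _)
    (fun u _ => hβ.can_transition ht hP m
      (L := fun ω => lowerCoeff (γ ω) u) (U := fun ω => upperCoeff (a ω) (γ ω) u)
      (matCoeffs_subset fun r s => by
        simp only [lowerCoeff, Matrix.of_apply]
        split_ifs with hu
        · refine hγ _ _ ?_ (by omega)
          exact le_add_right (Nat.le_mul_of_pos_left t hu.1)
        · exact coeffSet_const_subset 0)
      (matCoeffs_subset fun r s => by
        simp only [upperCoeff, Matrix.of_apply]
        split_ifs with hu hs hrs
        · exact ha r r.2
        · exact coeffSet_const_subset 0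
        · rw [Fin.le_def] at hrs
          refine hγ _ _ ?_ (by omega)
          exact le_add_right (Nat.le_mul_of_pos_left t (Nat.pos_of_ne_zero hu))
        · exact coeffSet_const_subset 0)
      (fun ω => graded_lowerCoeff (h.natDegree_coeff_le ω) u)
      (fun ω => graded_upperCoeff (h.natDegree_le ω) (h.natDegree_coeff_le ω) u))
  refine ⟨Z, hZ.mono_cost ?_, hpre⟩
  have hβ0 := hβ.nonneg
  have h₁ : (t : ℝ) ^ 2 * β ≤ P.cost * β := by gcongr
  have h₂ : m * (2 * (P.cost * β) + (t : ℝ) ^ 2 * β) ≤ m * (3 * (P.cost * β)) := by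
    gcongr
    linarith
  have h₃ : ((k : ℝ) + 1) * (2 * t ^ 2 * β) ≤ (k + 1) * (2 * (P.cost * β)) :=
    mul_le_mul_of_nonneg_left (by linarith) (by positivity)
  calc _ ≤ (2 : ℝ) ^ k * (m * (3 * (P.cost * β)) + P.cost * β + k * (P.cost * β) +
        (k + 1) * (2 * (P.cost * β))) := by gcongr
    _ = _ := by ring

end ScalarRecurrence

/-! ### Matrices of recurrence width t and the two programs -/

section Recurrence

variable {F : Type u} [Field F] {N t : ℕ}

theorem coeff_rowPoly (A : Matrix (Fin N) (Fin N) F) (i : Fin N) (d : ℕ) :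
    (rowPoly A i).coeff d = if h : d < N then A i ⟨d, h⟩ else 0 := by
  rw [rowPoly, finsetSum_coeff]
  simp only [coeff_C_mul, coeff_X_pow]
  split_ifs with h
  · rw [Finset.sum_eq_single ⟨d, h⟩]
    · simp
    · intro j _ hj
      rw [if_neg, mul_zero]
      rintro rfl
      exact hj rfl
    · simp
  · refine Finset.sum_eq_zero fun j _ => ?_
    rw [if_neg (by omega), mul_zero]

/-- The row polynomials of a matrix, followed by zeros. -/
noncomputable def rowSeq (A : Matrix (Fin N) (Fin N) F) (i : ℕ) : F[X] :=
  if h : i < N then rowPoly A ⟨i, h⟩ else 0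

/-- The coefficients of the recurrence, followed by zeros. -/
noncomputable def coeffSeq (g : Fin N → Fin t → F[X]) (i j : ℕ) : F[X] :=
  if h : (t ≤ i ∧ i < N) ∧ j < t then g ⟨i, h.1.2⟩ ⟨j, h.2⟩ else 0

variable {A : Matrix (Fin N) (Fin N) F} {g : Fin N → Fin t → F[X]}

theorem natDegree_coeffSeq_le (h : SatisfiesRecurrence A g) (i j : ℕ) :
    (coeffSeq g i j).natDegree ≤ j + 1 := by
  rw [coeffSeq]
  split_ifs with hij
  · exact h.degree_coeff _ hij.1.1 _
  · simp

/-- Beyond the matrix both sides vanish. Hence the order can be lowered to min t N: if t > N, only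
these trivial relations remain. -/
theorem rowSeq_eq_sum (h : SatisfiesRecurrence A g) {i : ℕ} (hi : min t N ≤ i) :
    rowSeq A i = ∑ j ∈ Finset.range (min t N), coeffSeq g i j * rowSeq A (i - (j + 1)) := by
  by_cases hiN : i < N
  · have ht : min t N = t := by omega
    rw [ht] at hi ⊢
    rw [rowSeq, dif_pos hiN, h.recurrence ⟨i, hiN⟩ hi, Finset.sum_range]
    refine Finset.sum_congr rfl fun j _ => ?_
    rw [coeffSeq, dif_pos ⟨⟨hi, hiN⟩, j.2⟩, rowSeq, dif_pos ((Nat.sub_le _ _).trans_lt hiN)]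
  · rw [rowSeq, dif_neg hiN, Finset.sum_eq_zero]
    intro j _
    rw [coeffSeq, dif_neg (fun h => hiN h.1.2), zero_mul]

theorem natDegree_rowSeq_le (h : SatisfiesRecurrence A g) (i : ℕ) :
    (rowSeq A i).natDegree ≤ i := by
  induction i using Nat.strong_induction_on with
  | _ i ih =>
    by_cases hi : min t N ≤ i
    · rw [rowSeq_eq_sum h hi]
      refine natDegree_sum_le_of_forall_le _ _ fun j hj => ?_
      rw [Finset.mem_range] at hj
      have h₁ := natDegree_mul_le (p := coeffSeq g i j) (q := rowSeq A (i - (j + 1)))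
      have h₂ := natDegree_coeffSeq_le h i j
      have h₃ := ih (i - (j + 1)) (by omega)
      omega
    · have hiN : i < N := by omega
      rw [rowSeq, dif_pos hiN]
      exact h.initial _ (by simp only; omega)

/-- The degree bounds make A lower triangular, so its determinant is the product of these
coefficients. -/
theorem coeff_rowSeq_self_ne_zero (h : SatisfiesRecurrence A g) (hA : IsUnit A) {i : ℕ}
    (hi : i < N) : (rowSeq A i).coeff i ≠ 0 := by
  have hdet : A.det = ∏ i, A i i := by
    refine Matrix.det_of_isLowerTriangular A fun i j hij => ?_
    have hij : i < j := hij
    have h₁ := natDegree_rowSeq_le h i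
    have h₂ : (rowSeq A i).coeff j = A i j := by
      rw [rowSeq, dif_pos i.2, coeff_rowPoly, dif_pos j.2]
    rw [← h₂]
    exact coeff_eq_zero_of_natDegree_lt (lt_of_le_of_lt h₁ hij)
  have hne : A.det ≠ 0 := ((Matrix.isUnit_iff_isUnit_det A).1 hA).ne_zero
  rw [hdet, Finset.prod_ne_zero_iff] at hne
  rw [rowSeq, dif_pos hi, coeff_rowPoly, dif_pos hi]
  exact hne ⟨i, hi⟩ (Finset.mem_univ _)

instance : Finite (RecurrenceIndex N t) := by
  refine Finite.of_injective (β := (Σ i : Fin N, Fin ((i : ℕ) + 1)) ⊕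
    (Fin N × Σ j : Fin t, Fin ((j : ℕ) + 2))) (fun
    | .initial i _ c => Sum.inl ⟨i, c⟩
    | .coeff i _ j c => Sum.inr (i, ⟨j, c⟩)) ?_
  rintro (⟨i, hi, c⟩ | ⟨i, hi, j, c⟩) (⟨i', hi', c'⟩ | ⟨i', hi', j', c'⟩) h
  · cases h
    rfl
  · cases h
  · cases h
  · cases h
    rfl

/-- The invertible matrices of recurrence width `t`, with the coefficients of the recurrence. -/
abbrev Instance (F : Type u) [Field F] (N t : ℕ) : Type u :=
  {p : Matrix (Fin N) (Fin N) F × (Fin N → Fin t → F[X]) //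
    SatisfiesRecurrence p.1 p.2 ∧ IsUnit p.1}

theorem isRecurrence_rowSeq : IsRecurrence (min t N) (fun ω : Instance F N t => rowSeq ω.1.1)
    (fun ω => coeffSeq ω.1.2) where
  natDegree_le ω := natDegree_rowSeq_le ω.2.1
  natDegree_coeff_le ω := natDegree_coeffSeq_le ω.2.1
  recurrence ω _ := rowSeq_eq_sum ω.2.1

/-- The input of the pre-processing, as functions of the instance. -/
noncomputable def inputs (F : Type u) [Field F] (N t : ℕ) (e : RecurrenceIndex N t)
    (ω : Instance F N t) : F := recurrenceInput ω.1.1 ω.1.2 e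

theorem coeffSet_rowSeq_subset {i : ℕ} (hi : i < min t N) :
    coeffSet (fun ω : Instance F N t => rowSeq ω.1.1 i) Set.univ ⊆
      cl (Set.range (inputs F N t)) := by
  have hiN : i < N := by omega
  refine coeffSet_subset fun d _ => ?_
  by_cases hd : d < i + 1
  · refine subset_cl ⟨.initial ⟨i, hiN⟩ (by simp only; omega) ⟨d, hd⟩, ?_⟩
    funext ω
    rw [rowSeq, dif_pos hiN]
    rfl
  · exact zero_mem_cl' fun ω => coeff_eq_zero_of_natDegree_lt
      ((natDegree_rowSeq_le ω.2.1 i).trans_lt (by omega))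

theorem coeffSet_coeffSeq_subset (i j : ℕ) :
    coeffSet (fun ω : Instance F N t => coeffSeq ω.1.2 i j) Set.univ ⊆
      cl (Set.range (inputs F N t)) := by
  refine coeffSet_subset fun d _ => ?_
  by_cases h : (t ≤ i ∧ i < N) ∧ j < t
  · by_cases hd : d < j + 2
    · refine subset_cl ⟨.coeff ⟨i, h.1.2⟩ h.1.1 ⟨j, h.2⟩ ⟨d, hd⟩, ?_⟩
      funext ω
      rw [coeffSeq, dif_pos h]
      rfl
    · exact zero_mem_cl' fun ω => coeff_eq_zero_of_natDegree_lt
        ((natDegree_coeffSeq_le ω.2.1 i j).trans_lt (by omega))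
  · refine zero_mem_cl' fun ω => ?_
    rw [coeffSeq, dif_neg h, coeff_zero]

/-- The solution of the system, followed by zeros. -/
noncomputable def solution (A : Matrix (Fin N) (Fin N) F) (y : Fin N → F) (i : ℕ) : F :=
  if h : i < N then (A.transpose)⁻¹.mulVec y ⟨i, h⟩ else 0

theorem transpose_mulVec_solution (hA : IsUnit A) (y : Fin N → F) :
    A.transpose.mulVec (fun i => solution A y i) = y := by
  have : (fun i : Fin N => solution A y i) = (A.transpose)⁻¹.mulVec y := by
    funext i
    rw [solution, dif_pos i.2]
  rw [this, Matrix.mulVec_mulVec, Matrix.mul_nonsing_inv, Matrix.one_mulVec]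
  rw [Matrix.det_transpose]
  exact (Matrix.isUnit_iff_isUnit_det A).1 hA

/-- The linear system as an identity of polynomials, padded with zeros to fill a complete binary
tree of blocks. -/
theorem coeff_sum_solution (hA : IsUnit A) (y : Fin N → F) {B : ℕ} (hB : N ≤ B) (d : ℕ) :
    (∑ i ∈ Finset.range B, C (solution A y i) * rowSeq A i).coeff d =
      if h : d < N then y ⟨d, h⟩ else 0 := by
  have hsub : ∑ i ∈ Finset.range B, C (solution A y i) * rowSeq A i =
      ∑ i ∈ Finset.range N, C (solution A y i) * rowSeq A i := by
    symm
    refine Finset.sum_subset (Finset.range_mono hB) fun i _ hi => ?_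
    rw [Finset.mem_range] at hi
    rw [rowSeq, dif_neg hi, mul_zero]
  rw [hsub, Finset.sum_range, finsetSum_coeff]
  simp only [coeff_C_mul, rowSeq, Fin.is_lt, dif_pos, Fin.eta, coeff_rowPoly]
  split_ifs with h
  · conv_rhs => rw [← transpose_mulVec_solution hA y]
    rw [Matrix.mulVec, dotProduct]
    exact Finset.sum_congr rfl fun i _ => mul_comm _ _
  · simp

theorem coeffSet_comp_subset {Ω Ω' : Type*} (f : Ω' → Ω) {p : Ω → F[X]} {I : Set ℕ}
    {S : Set (Ω → F)} (h : coeffSet p I ⊆ cl S) :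
    coeffSet (fun ω => p (f ω)) I ⊆ cl ((fun q => q ∘ f) '' S) := by
  refine coeffSet_subset fun d hd => ?_
  rcases mem_of_coeffSet_subset h hd with h | ⟨a, ha⟩
  · exact subset_cl ⟨_, h, rfl⟩
  · exact Or.inr ⟨a, funext fun ω => congrFun ha (f ω)⟩

/-- Used with the projection from pairs (matrix, y) to matrices: the solving program has the pairs
as instances. -/
theorem PreKnown.comp {Ω Ω' : Type*} (f : Ω' → Ω) {T : Ω → ℕ → Matrix (Fin t) (Fin t) F[X]}
    {V : Ω → ℕ → Fin t → F[X]} {k : ℕ} {S : Set (Ω → F)} (h : PreKnown T V k S) :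
    PreKnown (fun ω => T (f ω)) (fun ω => V (f ω)) k ((fun q => q ∘ f) '' S) where
  tree l u hl hu := matCoeffs_subset fun i j => coeffSet_comp_subset f
    ((coeffSet_subset_matCoeffs (fun ω => prodTree (T ω) l u) i j).trans (h.tree l u hl hu))
  window l u s hl hu := coeffSet_comp_subset f (h.window l u s hl hu)
  leaf u s hu := coeffSet_comp_subset f (h.leaf u s hu)

theorem IsBlockRecurrence.comp {Ω Ω' : Type*} (f : Ω' → Ω)
    {T : Ω → ℕ → Matrix (Fin t) (Fin t) F[X]} {V : Ω → ℕ → Fin t → F[X]}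
    (h : IsBlockRecurrence T V) :
    IsBlockRecurrence (fun ω => T (f ω)) (fun ω => V (f ω)) :=
  ⟨fun ω => h.step (f ω), fun ω => h.graded (f ω), fun ω => h.natDegree_zero (f ω),
    fun ω => h.natDegree_succ (f ω)⟩

theorem exists_programs {M : ℕ → ℝ} (hM : IsPolyMulTime F M) (hN : 1 ≤ N) (ht : 1 ≤ t) {t' k m : ℕ}
    (ht' : t' = min t N)
    (hk : ∀ l < k, 2 ^ l * t' ≤ N) (hkN : N ≤ 2 ^ k * t') (hm : t' ≤ 2 ^ m)
    {P : SLP F ((Fin (t') × Fin (t')) ⊕ (Fin (t') × Fin (t')))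
      (Fin (t') × Fin (t'))}
    (hP : ∀ (R : Type u) [CommRing R] [Algebra F R] (Y Z : Matrix (Fin (t')) (Fin (t')) R),
        P.Computes (Sum.elim (fun e => Y e.1 e.2) (fun e => Z e.1 e.2))
          (fun e => (Y * Z) e.1 e.2)) {β : ℝ}
    (hβ : β = 960 * ((t' : ℕ) * (M N / N))) :
    ∃ (s : ℕ) (pre : SLP F (RecurrenceIndex N t) (Fin s)) (solve : SLP F (Fin s ⊕ Fin N) (Fin N)),
      (pre.cost : ℝ) ≤ 3 * (m + k + 1) * (P.cost * (2 ^ k * β)) ∧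
      (solve.cost : ℝ) ≤ (k + 1) * (2 ^ k * (6 * (t' : ℕ) ^ 2 * β)) ∧
      ∀ (A : Matrix (Fin N) (Fin N) F) (g : Fin N → Fin t → F[X]),
        SatisfiesRecurrence A g → IsUnit A →
        ∃ p : Fin s → F, pre.Computes (recurrenceInput A g) p ∧
          ∀ y : Fin N → F, ∃ x : Fin N → F,
            solve.Computes (Sum.elim p y) x ∧ A.transpose.mulVec x = y := by
  have hrec : IsRecurrence t' (fun ω : Instance F N t => rowSeq ω.1.1) fun ω => coeffSeq ω.1.2 :=
    ht' ▸ isRecurrence_rowSeq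
  have hrow : ∀ i < t', coeffSet (fun ω : Instance F N t => rowSeq ω.1.1 i) Set.univ ⊆
      cl (Set.range (inputs F N t)) := fun i hi => coeffSet_rowSeq_subset (ht' ▸ hi)
  have ht1 : 1 ≤ t' := by omega
  have htN : t' ≤ N := by omega
  have hmb : ∀ Ω : Type u, MulBound Ω F t' k β := fun Ω => by
    rw [hβ]
    exact MulBound.of_isPolyMulTime hM ht1 htN hk
  obtain ⟨Z, ⟨l, hl, hchain, hZ⟩, hpre⟩ := hrec.exists_preKnown (hmb _) ht1 hm
    (fun Y Z => hP F[X] Y Z) (sq_le_cost_of_matMul fun Y Z => hP F Y Z) hrow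
    (fun i j _ _ => coeffSet_coeffSeq_subset i j)
  set E : Set (Instance F N t → F) := Set.range (inputs F N t) ∪ {f | f ∈ l} with hE
  have hEfin : E.Finite := (Set.finite_range _).union l.finite_toSet
  -- The vector p lists all inputs and all intermediate results of the pre-processing; returning
  -- them costs no operation.
  obtain ⟨s, p, hp⟩ : ∃ (s : ℕ) (p : Fin s → Instance F N t → F), Set.range p = E := by
    have := hEfin.fintype
    refine ⟨Fintype.card E, fun j => ((Fintype.equivFin E).symm j : E), ?_⟩
    rw [Set.range_comp' Subtype.val, (Fintype.equivFin E).symm.surjective.range_eq, Set.image_univ,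
      Subtype.range_coe]
  obtain ⟨pre, hprec, hprecomp⟩ := Can.exists_program (inp := inputs F N t) (v := p)
    ⟨l, hl, hchain, by rw [hp]; exact subset_cl⟩
  have hE' : PreKnown _ (fun ω : Instance F N t => blocks t' (rowSeq ω.1.1)) k E :=
    hpre.mono (Set.union_subset (Set.subset_union_left.trans subset_cl) hZ)
  have hk' := (hE'.comp (Prod.fst : Instance F N t × (Fin N → F) → Instance F N t))
  set inp : Fin s ⊕ Fin N → Instance F N t × (Fin N → F) → F :=
    Sum.elim (fun j ω => p j ω.1) (fun i ω => ω.2 i) with hinp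
  have hsolve := ((hrec.isBlockRecurrence ht1 hm).comp Prod.fst).can_solve (hmb _) ht1
    (x := fun (ω : Instance F N t × (Fin N → F)) b r => solution ω.1.1.1 ω.2 (b * t' + r)) (by
      intro b r
      by_cases hbr : b * t' + r < N
      · exact Or.inl fun ω => coeff_rowSeq_self_ne_zero ω.1.2.1 ω.1.2.2 hbr
      · exact Or.inr fun ω => dif_neg hbr) k le_rfl 0 (by simp) (Set.range inp)
    (hk'.mono (Set.Subset.trans (by
      rintro _ ⟨f, hf, rfl⟩
      rw [← hp] at hf
      obtain ⟨j, rfl⟩ := hf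
      exact ⟨Sum.inl j, rfl⟩) subset_cl))
    (coeffSet_subset fun d _ => by
      simp only [zero_add, one_mul, partialSum_blocks]
      by_cases hd : d < N
      · refine subset_cl ⟨Sum.inr ⟨d, hd⟩, ?_⟩
        funext ω
        rw [coeff_sum_solution ω.1.2.2 _ hkN, dif_pos hd]
        rfl
      · refine zero_mem_cl' fun ω => ?_
        rw [coeff_sum_solution ω.1.2.2 _ hkN, dif_neg hd])
  obtain ⟨solve, hsolvec, hsolvecomp⟩ := Can.exists_program
    (v := fun (i : Fin N) ω => solution ω.1.1.1 ω.2 i) (hsolve.mono_right (by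
      rintro _ ⟨i, rfl⟩
      refine subset_cl (Or.inl (Set.mem_biUnion (x := (i : ℕ) / t') ?_
        ⟨⟨(i : ℕ) % t', Nat.mod_lt _ ht1⟩, ?_⟩))
      · rw [Set.mem_Ico, zero_mul, zero_add, one_mul]
        exact ⟨Nat.zero_le _, (Nat.div_lt_iff_lt_mul ht1).2 (i.2.trans_le hkN)⟩
      · funext ω
        simp only [Nat.div_add_mod']))
  refine ⟨s, pre, solve, hprec, hsolvec, fun A g hAg hA => ?_⟩
  set ω : Instance F N t := ⟨(A, g), hAg, hA⟩ with hω
  refine ⟨fun j => p j ω, hprecomp ω, fun y => ⟨_, ?_, transpose_mulVec_solution hA y⟩⟩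
  convert hsolvecomp (ω, y) using 1
  funext i
  rcases i with i | i <;> rfl

end Recurrence

end StraightLine

/-! ### The theorem: choice of the depth of the tree and final estimates -/

theorem mainTheorem6 (ω c : ℝ) :
    ∃ K : ℝ, 0 < K ∧
      ∀ (F : Type*) [Field F], IsMatMulExponent F ω c →
      ∀ M : ℕ → ℝ, IsPolyMulTime F M →
      ∀ N t : ℕ, 2 ≤ N → 1 ≤ t →
        ∃ (s : ℕ) (pre : SLP F (RecurrenceIndex N t) (Fin s))
          (solve : SLP F (Fin s ⊕ Fin N) (Fin N)),
          (pre.cost : ℝ) ≤ K * ((t : ℝ) ^ ω * M N * Real.log N) ∧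
          (solve.cost : ℝ) ≤ K * ((t : ℝ) ^ 2 * M N * Real.log N ^ 2) ∧
          ∀ (A : Matrix (Fin N) (Fin N) F) (g : Fin N → Fin t → F[X]),
            SatisfiesRecurrence A g → IsUnit A →
            ∃ p : Fin s → F, pre.Computes (recurrenceInput A g) p ∧
              ∀ y : Fin N → F, ∃ x : Fin N → F,
                solve.Computes (Sum.elim p y) x ∧ A.transpose.mulVec x = y := by
  refine ⟨200000 * (|c| + 1), by positivity, fun F _ hMM M hM N t hN ht => ?_⟩
  obtain ⟨t', ht'⟩ : ∃ t', t' = min t N := ⟨_, rfl⟩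
  have ht1 : 1 ≤ t' := by omega
  have hc := hMM.one_le
  have hω := hMM.exponent_nonneg
  have hex : ∃ k, N ≤ 2 ^ k * t' := ⟨N, (Nat.lt_two_pow_self (n := N)).le.trans
    (Nat.le_mul_of_pos_right _ ht1)⟩
  classical
  -- The least depth for which the leaves cover all rows: lower levels have degrees below N, and 2^k
  -- * t' is at most 2N.
  obtain ⟨k, hkN, hk⟩ : ∃ k, N ≤ 2 ^ k * t' ∧ ∀ l < k, 2 ^ l * t' < N :=
    ⟨Nat.find hex, Nat.find_spec hex, fun l hl => not_le.1 (Nat.find_min hex hl)⟩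
  obtain ⟨P, hPc, hP⟩ := hMM t' ht1
  obtain ⟨s, pre, solve, hpre, hsolve, hAll⟩ := StraightLine.exists_programs hM (by omega) ht
    (m := Nat.clog 2 t') ht' (fun l hl => (hk l hl).le) hkN (Nat.le_pow_clog one_lt_two t') hP rfl
  refine ⟨s, pre, solve, hpre.trans ?_, hsolve.trans ?_, hAll⟩
  all_goals
    have hN0 : (0 : ℝ) < N := by positivity
    have htt : (t' : ℝ) ≤ t := by exact_mod_cast (by omega : t' ≤ t)
    have hlog2 : (1 / 2 : ℝ) ≤ Real.log 2 := by linarith [Real.log_two_gt_d9]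
    have hlogN : Real.log 2 ≤ Real.log N := Real.log_le_log two_pos (by exact_mod_cast hN)
    -- From j log 2 ≤ log 2 + log N ≤ 2 log N and log 2 ≥ 1/2.
    have hlog : ∀ j : ℕ, (2 : ℕ) ^ j < 2 * N → (j : ℝ) ≤ 4 * Real.log N := by
      intro j hj
      have h₁ : (2 : ℝ) ^ j ≤ 2 * N := by exact_mod_cast hj.le
      have h₂ := Real.log_le_log (by positivity) h₁
      rw [Real.log_pow, Real.log_mul two_ne_zero hN0.ne'] at h₂
      have h₃ : (j : ℝ) * (1 / 2) ≤ j * Real.log 2 := by gcongr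
      linarith
    have hk4 : (k : ℝ) ≤ 4 * Real.log N := by
      refine hlog k ?_
      rcases k with _ | k
      · omega
      · have h₁ := hk k (Nat.lt_succ_self k)
        have h₂ : 2 ^ k ≤ 2 ^ k * t' := Nat.le_mul_of_pos_right _ ht1
        rw [pow_succ]
        omega
    have hMN : (N : ℝ) ≤ M N := hM.le_self (by omega)
    have hM0 : 0 < M N := hN0.trans_le hMN
    have hβ : (2 : ℝ) ^ k * (960 * ((t' : ℕ) * (M N / N))) ≤ 1920 * M N := by
      have h₁ : (2 : ℝ) ^ k * t' ≤ 2 * N := by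
        have : 2 ^ k * t' ≤ 2 * N := by
          rcases k with _ | k
          · simp only [pow_zero, one_mul]
            omega
          · have h₁ := hk k (Nat.lt_succ_self k)
            rw [pow_succ, mul_right_comm]
            omega
        exact_mod_cast this
      calc (2 : ℝ) ^ k * (960 * ((t' : ℕ) * (M N / N)))
          = 960 * ((2 ^ k * t') * (M N / N)) := by ring
        _ ≤ 960 * ((2 * N) * (M N / N)) := by gcongr
        _ = 1920 * M N := by field_simp; norm_num
  · have hm4 : ((Nat.clog 2 t' : ℕ) : ℝ) ≤ 4 * Real.log N := by
      refine hlog _ ?_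
      rcases Nat.eq_or_lt_of_le ht1 with h | h
      · rw [← h]
        simp
        omega
      · have h₁ := Nat.pow_pred_clog_lt_self one_lt_two h
        have h₂ : Nat.clog 2 t' = (Nat.clog 2 t').pred + 1 :=
          (Nat.succ_pred_eq_of_pos (Nat.clog_pos one_lt_two h)).symm
        rw [h₂, pow_succ]
        omega
    have hP' : (P.cost : ℝ) ≤ |c| * (t : ℝ) ^ ω := hPc.trans (by
      gcongr
      · exact le_abs_self c)
    have hrp : (0 : ℝ) ≤ (t : ℝ) ^ ω := by positivity
    have hl0 : 0 ≤ Real.log N := by linarith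
    calc _ ≤ 3 * (4 * Real.log N + 4 * Real.log N + 2 * Real.log N) *
          ((|c| * (t : ℝ) ^ ω) * (1920 * M N)) := by
          gcongr
          linarith
      _ = (57600 * |c|) * ((t : ℝ) ^ ω * M N * Real.log N) := by ring
      _ ≤ _ := mul_le_mul_of_nonneg_right (by linarith [abs_nonneg c]) (by positivity)
  · have hl0 : 0 ≤ Real.log N := by linarith
    calc _ = ((k : ℝ) + 1) * (6 * t' ^ 2 * (2 ^ k * (960 * ((t' : ℕ) * (M N / N))))) := by ring
      _ ≤ (4 * Real.log N + 2 * Real.log N) * (6 * t ^ 2 * (1920 * M N)) := by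
          gcongr
          linarith
      _ = 69120 * (t ^ 2 * M N * (Real.log N * 1)) := by ring
      -- A single logarithm has been used so far; the second is slack, as 1 ≤ 2 log N.
      _ ≤ 69120 * (t ^ 2 * M N * (Real.log N * (2 * Real.log N))) := by
          gcongr
          linarith
      _ = 138240 * (t ^ 2 * M N * Real.log N ^ 2) := by ring
      _ ≤ _ := mul_le_mul_of_nonneg_right (by linarith [abs_nonneg c]) (by positivity)
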